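/- Let $\mathbb{F}=\mathbb{C}$ or $\mathbb{F}=\mathbb{H}$ (Hamilton's quaternions). For $A=A_1+A_2\mathbf{j}\in M(n,\mathbb{H})$ with $A_1,A_2\in M(n,\mathbb{C})$ put $\Phi(A)=\begin{pmatrix}A_1&A_2\\-\overline{A_2}&\overline{A_1}\end{pmatrix}\in M(2n,\mathbb{C})$, and define $SL(n,\mathbb{H})=\{g\in GL(n,\mathbb{H}):\det\Phi(g)=1\}$, $\mathfrak{sl}(n,\mathbb{H})=\{X\in M(n,\mathbb{H}):\operatorname{tr}\Phi(X)=0\}$. An eigenvalue of $X\in M(n,\mathbb{H})$ is a right eigenvalue, that is, $\lambda\in\mathbb{H}$ with $Xv=v\lambda$ for some $0\ne v\in\mathbb{H}^n$. The eigenvalues occur in similarity classes $[\lambda]=\{q^{-1}\lambda q: 0\neq q\in\mathbb{H}\}$, each of which contains exactly one complex number $\lambda^*$ with non-negative imaginary part. For $X\in M(n,\mathbb{C})$ the eigenvalue class of $\lambda$ is $\{\lambda\}$, and we put $\lambda^*=\lambda$. The multiplicity of the eigenvalue class of $\lambda$ is the algebraic multiplicity of $\lambda$ as an eigenvalue of $X$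 if $\mathbb{F}=\mathbb{C}$; if $\mathbb{F}=\mathbb{H}$, it is the algebraic multiplicity of $\lambda^*$ as an eigenvalue of $\Phi(X)$ when $\lambda^*\notin\mathbb{R}$, and half of it when $\lambda^*\in\mathbb{R}$. Every $X\in M(n,\mathbb{F})$ is conjugate under $GL(n,\mathbb{F})$ to a Jordan form, unique up to the order of its blocks, whose blocks have complex eigenvalues (with non-negative imaginary parts if $\mathbb{F}=\mathbb{H}$). The partition $\mathbf{d}_\lambda$ associated to the eigenvalue class of $\lambda$ is the multiset of the sizes of the Jordan blocks with eigenvalue $\lambda^*$; it is a partition of the multiplicity of that class. **Theorem.** Let $X\in\mathfrak{sl}(n,\mathbb{F})$. Then $X$ is $\mathrm{Ad}_{SL(n,\mathbb{F})}$-real, i.e. $-X=gXg^{-1}$ for some $g\in SL(n,\mathbb{F})$, if and only if both of the following conditions hold for every eigenvalue $\lambda$ of $X$ such that $\lambda\neq0$ (if $\mathbb{F}=\mathbb{C}$), respectively such that the real part of $\lambda$ is non-zero (if $\mathbb{F}=\mathbb{H}$): 1. $-\lambda$ is also an eigenvalue of $X$, and the eigenvalue classes of $\lambda$ and $-\lambda$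 have the same multiplicity; 2. if $m$ is the common multiplicity of the eigenvalue classes of $\lambda$ and $-\lambda$, then the partitions $\mathbf{d}_\lambda$ and $\mathbf{d}_{-\lambda}$ of $m$ associated to these classes are equal. -/

import Mathlib

open scoped Quaternion

noncomputable section

namespace AdReal

/-! ### Jordan forms over a ring -/

/-- The Jordan block `J(m, a)`: `a` on the diagonal, `1` on the superdiagonal, `0` elsewhere. -/
def jordanBlock {F : Type*} [Ring F] (m : ℕ) (a : F) : Matrix (Fin m) (Fin m) F :=
  Matrix.of fun i j => if i = j then a else if (i : ℕ) + 1 = j then 1 else 0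

/-- `X` is conjugate under `GL(n, F)` to the block diagonal matrix
`J(d 0, a 0) ⊕ ⋯ ⊕ J(d (r-1), a (r-1))`, all blocks being of positive size. The bijection `e`
numbers the rows (and columns) of the block diagonal matrix. -/
def HasJordanForm {F : Type*} [Ring F] {n r : ℕ} (X : Matrix (Fin n) (Fin n) F)
    (d : Fin r → ℕ) (a : Fin r → F) : Prop :=
  (∀ i, 0 < d i) ∧
    ∃ (e : (Σ i : Fin r, Fin (d i)) ≃ Fin n) (g : (Matrix (Fin n) (Fin n) F)ˣ),
      (g : Matrix (Fin n) (Fin n) F) * X * ((g⁻¹ : (Matrix (Fin n) (Fin n) F)ˣ) :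
          Matrix (Fin n) (Fin n) F) =
        Matrix.reindex e e (Matrix.blockDiagonal' fun i => jordanBlock (d i) (a i))

/-! ### Complex matrices -/

/-- The multiplicity of `l` as an eigenvalue of a complex matrix. -/
def complexMult {n : ℕ} (X : Matrix (Fin n) (Fin n) ℂ) (l : ℂ) : ℕ :=
  X.charpoly.rootMultiplicity l

/-- `p` is the partition attached to `l` by the Jordan form of `X`: its parts, with repetition, are
the sizes of the Jordan blocks with eigenvalue `l`. -/
def IsComplexPartition {n : ℕ} (X : Matrix (Fin n) (Fin n) ℂ) (l : ℂ) {m : ℕ}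
    (p : Nat.Partition m) : Prop :=
  ∃ (r : ℕ) (d : Fin r → ℕ) (a : Fin r → ℂ), HasJordanForm X d a ∧
    p.parts = ((Finset.univ : Finset (Fin r)).filter fun i => a i = l).val.map d

/-- `X` is `Ad`-real for `SL(n, ℂ)`. -/
def IsRealSLC {n : ℕ} (X : Matrix (Fin n) (Fin n) ℂ) : Prop :=
  ∃ g : Matrix.SpecialLinearGroup (Fin n) ℂ,
    -X = (g : Matrix (Fin n) (Fin n) ℂ) * X *
      ((g⁻¹ : Matrix.SpecialLinearGroup (Fin n) ℂ) : Matrix (Fin n) (Fin n) ℂ)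

/-! ### Quaternionic matrices -/

/-- The complex numbers `z`, `w` with `q = z + w j`: first `z`. -/
def fstPart (q : ℍ[ℝ]) : ℂ := ⟨q.re, q.imI⟩

/-- The complex numbers `z`, `w` with `q = z + w j`: second `w`. -/
def sndPart (q : ℍ[ℝ]) : ℂ := ⟨q.imJ, q.imK⟩

/-- The embedding `Φ` of `M(n, ℍ)` into `M(2n, ℂ)`: for `A = A₁ + A₂ j` with `A₁`, `A₂` complex,
`Φ A` has the blocks `A₁`, `A₂` in its first row and `-conj A₂`, `conj A₁` in its second. -/
def toComplex {n : ℕ} (A : Matrix (Fin n) (Fin n) ℍ[ℝ]) :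
    Matrix (Fin n ⊕ Fin n) (Fin n ⊕ Fin n) ℂ :=
  Matrix.fromBlocks (A.map fstPart) (A.map sndPart)
    (-(A.map fun q => starRingEnd ℂ (sndPart q))) (A.map fun q => starRingEnd ℂ (fstPart q))

theorem fstPart_sum {ι : Type*} (s : Finset ι) (f : ι → ℍ[ℝ]) :
    fstPart (∑ i ∈ s, f i) = ∑ i ∈ s, fstPart (f i) :=
  map_sum (⟨⟨fstPart, rfl⟩, fun _ _ => rfl⟩ : ℍ[ℝ] →+ ℂ) f s

theorem sndPart_sum {ι : Type*} (s : Finset ι) (f : ι → ℍ[ℝ]) :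
    sndPart (∑ i ∈ s, f i) = ∑ i ∈ s, sndPart (f i) :=
  map_sum (⟨⟨sndPart, rfl⟩, fun _ _ => rfl⟩ : ℍ[ℝ] →+ ℂ) f s

theorem fstPart_mul (p q : ℍ[ℝ]) :
    fstPart (p * q) = fstPart p * fstPart q - sndPart p * starRingEnd ℂ (sndPart q) := by
  apply Complex.ext <;> simp [fstPart, sndPart] <;> ring

theorem sndPart_mul (p q : ℍ[ℝ]) :
    sndPart (p * q) = fstPart p * sndPart q + sndPart p * starRingEnd ℂ (fstPart q) := by
  apply Complex.ext <;> simp [fstPart, sndPart] <;> ring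

theorem toComplex_mul {n : ℕ} (A B : Matrix (Fin n) (Fin n) ℍ[ℝ]) :
    toComplex (A * B) = toComplex A * toComplex B := by
  rw [toComplex, toComplex, toComplex, Matrix.fromBlocks_multiply]
  congr 1 <;> ext i j : 1 <;>
    simp only [Matrix.map_apply, Matrix.mul_apply, Matrix.add_apply, Matrix.neg_apply,
      fstPart_sum, sndPart_sum, fstPart_mul, sndPart_mul, map_sum, map_add, map_sub, map_mul,
      Complex.conj_conj, Finset.sum_add_distrib, Finset.sum_sub_distrib, mul_neg, neg_mul] <;> ring

theorem toComplex_one {n : ℕ} : toComplex (1 : Matrix (Fin n) (Fin n) ℍ[ℝ]) = 1 := by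
  have h1 : fstPart 1 = 1 := rfl
  have h2 : sndPart 1 = 0 := rfl
  have h3 : fstPart 0 = 0 := rfl
  have h4 : sndPart 0 = 0 := rfl
  rw [toComplex, ← Matrix.fromBlocks_one]
  congr 1 <;> ext i j : 1 <;> by_cases h : i = j <;> simp [Matrix.one_apply, h, h1, h2, h3, h4]

/-- The group `SL(n, ℍ)` of the invertible quaternionic matrices `g` with `det (Φ g) = 1`. -/
def SLH (n : ℕ) : Subgroup (Matrix (Fin n) (Fin n) ℍ[ℝ])ˣ where
  carrier := {g | (toComplex (g : Matrix (Fin n) (Fin n) ℍ[ℝ])).det = 1}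
  mul_mem' {a b} ha hb := by
    simp only [Set.mem_ofPred_eq] at ha hb ⊢
    rw [Units.val_mul, toComplex_mul, Matrix.det_mul, ha, hb, one_mul]
  one_mem' := by
    simp only [Set.mem_ofPred_eq]
    rw [Units.val_one, toComplex_one, Matrix.det_one]
  inv_mem' {a} ha := by
    simp only [Set.mem_ofPred_eq] at ha ⊢
    have h : toComplex (a : Matrix (Fin n) (Fin n) ℍ[ℝ]) *
        toComplex ((a⁻¹ : (Matrix (Fin n) (Fin n) ℍ[ℝ])ˣ) : Matrix (Fin n) (Fin n) ℍ[ℝ]) = 1 := by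
      rw [← toComplex_mul, Units.mul_inv, toComplex_one]
    have h' := congrArg Matrix.det h
    rwa [Matrix.det_mul, ha, one_mul, Matrix.det_one] at h'

/-- The set `sl(n, ℍ)` of the quaternionic matrices `X` with `tr (Φ X) = 0`. -/
def slH (n : ℕ) : Set (Matrix (Fin n) (Fin n) ℍ[ℝ]) :=
  {X | (toComplex X).trace = 0}

/-- `X` is `Ad`-real for `SL(n, ℍ)`. -/
def IsRealSLH {n : ℕ} (X : Matrix (Fin n) (Fin n) ℍ[ℝ]) : Prop :=
  ∃ g ∈ SLH n, -X = (g : Matrix (Fin n) (Fin n) ℍ[ℝ]) * X *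
    ((g⁻¹ : (Matrix (Fin n) (Fin n) ℍ[ℝ])ˣ) : Matrix (Fin n) (Fin n) ℍ[ℝ])

/-- `l` is a right eigenvalue of `X`: `X v = v l` for some non-zero vector `v`. -/
def IsRightEigenvalue {n : ℕ} (X : Matrix (Fin n) (Fin n) ℍ[ℝ]) (l : ℍ[ℝ]) : Prop :=
  ∃ v : Fin n → ℍ[ℝ], v ≠ 0 ∧ X.mulVec v = fun i => v i * l

/-- The unique complex number with non-negative imaginary part in the similarity class
`{q⁻¹ l q | q ≠ 0}` of the quaternion `l`. -/
def complexRep (l : ℍ[ℝ]) : ℂ := ⟨l.re, ‖l.im‖⟩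

/-- The multiplicity of the eigenvalue class of `l` in `X`. A class with non-real complex
representatives `z`, `conj z` and multiplicity `m` contributes to `Φ X` the eigenvalues `z` and
`conj z`, each `m` times; a class `{x}` with `x` real and multiplicity `m` contributes `x`,
`2 m` times. -/
def quaternionMult {n : ℕ} (X : Matrix (Fin n) (Fin n) ℍ[ℝ]) (l : ℍ[ℝ]) : ℕ :=
  if (complexRep l).im = 0 then (toComplex X).charpoly.rootMultiplicity (complexRep l) / 2
  else (toComplex X).charpoly.rootMultiplicity (complexRep l)

/-- `p` is the partition attached to the eigenvalue class of `l` by the Jordan form of `X`, in which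
the eigenvalues of the blocks are complex with non-negative imaginary part: the parts of `p`, with
repetition, are the sizes of the Jordan blocks whose eigenvalue is the one in the class of `l`. -/
def IsQuaternionPartition {n : ℕ} (X : Matrix (Fin n) (Fin n) ℍ[ℝ]) (l : ℍ[ℝ]) {m : ℕ}
    (p : Nat.Partition m) : Prop :=
  ∃ (r : ℕ) (d : Fin r → ℕ) (a : Fin r → ℂ), (∀ i, 0 ≤ (a i).im) ∧
    HasJordanForm X d (fun i => (a i : ℍ[ℝ])) ∧
    p.parts = ((Finset.univ : Finset (Fin r)).filter fun i => a i = complexRep l).val.map d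

end AdReal

end

/-! The determinant condition costs nothing. Over ℂ a conjugating matrix can be rescaled by an n-th
root of the inverse of its determinant. Over ℍ the determinant of Φ(g) is a positive real, so a real
scalar suffices. Hence `X` is Ad-real if and only if `X` is similar to `-X` (`isRealSLC_iff`,
`isRealSLH_iff`), and this is read off from Jordan forms.

Over ℂ, the multiset of pairs (block size, eigenvalue) exists (`exists_hasJordanType`) and is a
complete similarity invariant (`HasJordanType.unique`). Since `-J(m, a)` is similar to `J(m, -a)`,
negating `X` negates the eigenvalues in this multiset. So `X` is similar to `-X` exactly when `l`
and `-l` carry the same block sizes for all `l ≠ 0`; for `l = 0` there is nothing to check.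

Over ℍ everything is transported to Φ(X). Quaternionic matrices are similar as soon as their images
under Φ are similar over ℂ (`similar_of_similar_complexify`), and a quaternionic Jordan type `s`
becomes `s + conjType s` (`hasJordanType_quaternionType_iff`). With representatives in the closed
upper half plane, negation acts by `z ↦ -conj z`. This map fixes the imaginary axis, which is why
only eigenvalues of non-zero real part are constrained.

Finally, the multiplicity is the sum of the block sizes, and a class is an eigenvalue class exactly
when it has blocks; `conditions_iff` then turns equality of sizes into the two stated conditions. -/

noncomputable section

namespace AdReal

open Matrix

/-! ### Similarity of square matrices over possibly different index types -/

section Similar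

variable {F : Type*} [Ring F] {l m n : Type*} [Fintype l] [DecidableEq l] [Fintype m]
  [DecidableEq m] [Fintype n] [DecidableEq n]

/-- Two square matrices are similar if an invertible matrix intertwines them. The index types may
differ. -/
def Similar (A : Matrix m m F) (B : Matrix n n F) : Prop :=
  ∃ (P : Matrix m n F) (Q : Matrix n m F), P * Q = 1 ∧ Q * P = 1 ∧ A * P = P * B

theorem Similar.symm {A : Matrix m m F} {B : Matrix n n F} : Similar A B → Similar B A := by
  rintro ⟨P, Q, h1, h2, h⟩
  refine ⟨Q, P, h2, h1, ?_⟩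
  calc B * Q = Q * (P * B) * Q := by rw [← Matrix.mul_assoc Q P, h2, Matrix.one_mul]
    _ = Q * A := by rw [← h, Matrix.mul_assoc, Matrix.mul_assoc, h1, Matrix.mul_one]

theorem Similar.trans {A : Matrix l l F} {B : Matrix m m F} {C : Matrix n n F} :
    Similar A B → Similar B C → Similar A C := by
  rintro ⟨P, Q, h1, h2, h⟩ ⟨P', Q', h1', h2', h'⟩
  refine ⟨P * P', Q' * Q, ?_, ?_, ?_⟩
  · rw [Matrix.mul_assoc, ← Matrix.mul_assoc P' Q' Q, h1', Matrix.one_mul, h1]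
  · rw [Matrix.mul_assoc, ← Matrix.mul_assoc Q P P', h2, Matrix.one_mul, h2']
  · rw [← Matrix.mul_assoc, h, Matrix.mul_assoc, h', ← Matrix.mul_assoc]

theorem Similar.neg {A : Matrix m m F} {B : Matrix n n F} : Similar A B → Similar (-A) (-B) := by
  rintro ⟨P, Q, h1, h2, h⟩
  exact ⟨P, Q, h1, h2, by simp [h]⟩

theorem Similar.pow {A : Matrix m m F} {B : Matrix n n F} (hAB : Similar A B) (k : ℕ) :
    Similar (A ^ k) (B ^ k) := by
  obtain ⟨P, Q, h1, h2, h⟩ := hAB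
  refine ⟨P, Q, h1, h2, ?_⟩
  induction k with
  | zero => simp
  | succ k ih => rw [pow_succ, Matrix.mul_assoc, h, ← Matrix.mul_assoc, ih, Matrix.mul_assoc,
      ← pow_succ]

theorem Similar.map {F' : Type*} [Ring F'] (φ : F →+* F') {A : Matrix m m F} {B : Matrix n n F} :
    Similar A B → Similar (A.map φ) (B.map φ) := by
  rintro ⟨P, Q, h1, h2, h⟩
  refine ⟨P.map φ, Q.map φ, ?_, ?_, ?_⟩
  · rw [← Matrix.map_mul, h1, Matrix.map_one _ (map_zero φ) (map_one φ)]
  · rw [← Matrix.map_mul, h2, Matrix.map_one _ (map_zero φ) (map_one φ)]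
  · rw [← Matrix.map_mul, h, Matrix.map_mul]

theorem similar_submatrix (A : Matrix m m F) (e : n ≃ m) : Similar A (A.submatrix e e) := by
  refine ⟨(1 : Matrix m m F).submatrix id e, (1 : Matrix m m F).submatrix e id, ?_, ?_, ?_⟩
  · rw [Matrix.submatrix_mul_equiv]; simp
  · simpa using Matrix.submatrix_mul_equiv (1 : Matrix m m F) (1 : Matrix m m F) e (Equiv.refl m) e
  · have h1 := Matrix.submatrix_mul_equiv A (1 : Matrix m m F) id (Equiv.refl m) e
    have h2 := Matrix.submatrix_mul_equiv (1 : Matrix m m F) A id e e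
    simp only [Equiv.coe_refl, Matrix.submatrix_id_id, Matrix.mul_one, Matrix.one_mul] at h1 h2
    rw [h1, h2]

theorem Similar.blockDiagonal' {ι : Type*} [Fintype ι] [DecidableEq ι] {m n : ι → Type*}
    [∀ i, Fintype (m i)] [∀ i, DecidableEq (m i)] [∀ i, Fintype (n i)] [∀ i, DecidableEq (n i)]
    {A : ∀ i, Matrix (m i) (m i) F} {B : ∀ i, Matrix (n i) (n i) F}
    (h : ∀ i, Similar (A i) (B i)) :
    Similar (Matrix.blockDiagonal' A) (Matrix.blockDiagonal' B) := by
  choose P Q h1 h2 h3 using h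
  refine ⟨Matrix.blockDiagonal' P, Matrix.blockDiagonal' Q, ?_, ?_, ?_⟩
  · rw [← Matrix.blockDiagonal'_mul]; simp only [h1]; exact Matrix.blockDiagonal'_one
  · rw [← Matrix.blockDiagonal'_mul]; simp only [h2]; exact Matrix.blockDiagonal'_one
  · rw [← Matrix.blockDiagonal'_mul, ← Matrix.blockDiagonal'_mul]; simp only [h3]

theorem Similar.card_eq [InvariantBasisNumber F] {A : Matrix m m F} {B : Matrix n n F} :
    Similar A B → Fintype.card m = Fintype.card n := by
  rintro ⟨P, Q, h1, h2, -⟩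
  exact Matrix.square_of_invertible P Q h1 h2

theorem similar_iff_exists_units {A B : Matrix n n F} :
    Similar A B ↔ ∃ g : (Matrix n n F)ˣ,
      (g : Matrix n n F) * A * ((g⁻¹ : (Matrix n n F)ˣ) : Matrix n n F) = B := by
  constructor
  · rintro ⟨P, Q, h1, h2, h⟩
    refine ⟨⟨Q, P, h2, h1⟩, ?_⟩
    change Q * A * P = B
    rw [Matrix.mul_assoc, h, ← Matrix.mul_assoc, h2, Matrix.one_mul]
  · rintro ⟨g, rfl⟩
    refine ⟨((g⁻¹ : (Matrix n n F)ˣ) : Matrix n n F), g, g.inv_mul, g.mul_inv, ?_⟩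
    rw [← Matrix.mul_assoc, ← Matrix.mul_assoc, g.inv_mul, Matrix.one_mul]

end Similar

/-! ### Jordan matrices indexed by families of sizes and eigenvalues -/

section JordanMatrix

/-- Equal multisets mean that corresponding fibres have equal cardinality; bijections of fibres are
glued. -/
theorem exists_equiv_of_map_univ_eq {α ι κ : Type*} [Fintype ι] [Fintype κ] {f : ι → α} {g : κ → α}
    (h : Finset.univ.val.map f = Finset.univ.val.map g) : ∃ σ : ι ≃ κ, ∀ i, g (σ i) = f i := by
  classical
  have hc : ∀ c, Fintype.card {i // f i = c} = Fintype.card {j // g j = c} := fun c => by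
    have := congrArg (Multiset.count c) h
    rw [Multiset.count_map, Multiset.count_map] at this
    rw [Fintype.card_subtype, Fintype.card_subtype, Finset.card_def, Finset.card_def]
    simpa [eq_comm] using this
  exact ⟨Equiv.ofFiberEquiv fun c => Fintype.equivOfCardEq (hc c),
    fun i => Equiv.ofFiberEquiv_map _ i⟩

variable {F : Type*} [Ring F] {ι κ : Type*} [DecidableEq ι] [DecidableEq κ]

/-- The block diagonal matrix with the Jordan blocks `J(d, a)`, `(d, a) = f i`. -/
def jordanMatrix (f : ι → ℕ × F) : Matrix (Σ i, Fin (f i).1) (Σ i, Fin (f i).1) F :=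
  Matrix.blockDiagonal' fun i => jordanBlock (f i).1 (f i).2

theorem jordanBlock_map {F' : Type*} [Ring F'] (φ : F →+* F') (m : ℕ) (a : F) :
    (jordanBlock m a).map φ = jordanBlock m (φ a) := by
  ext i j
  simp only [jordanBlock, Matrix.map_apply, Matrix.of_apply]
  split_ifs <;> simp

theorem jordanMatrix_map {F' : Type*} [Ring F'] (φ : F →+* F') (f : ι → ℕ × F) :
    (jordanMatrix f).map φ = jordanMatrix fun i => ((f i).1, φ (f i).2) := by
  rw [jordanMatrix, Matrix.blockDiagonal'_map _ _ (map_zero φ)]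
  simp only [jordanBlock_map]
  rfl

variable [Fintype ι] [Fintype κ]

theorem similar_jordanMatrix_comp (g : κ → ℕ × F) (σ : ι ≃ κ) :
    Similar (jordanMatrix g) (jordanMatrix (g ∘ σ)) := by
  let e := Equiv.sigmaCongrLeft (β := fun j => Fin (g j).1) σ
  suffices h : jordanMatrix (g ∘ σ) = (jordanMatrix g).submatrix e e by
    rw [h]; exact similar_submatrix _ e
  ext ⟨i, x⟩ ⟨j, y⟩
  simp only [jordanMatrix, Function.comp_apply, Matrix.submatrix_apply, e,
    Equiv.sigmaCongrLeft_apply]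
  by_cases h : i = j
  · subst h
    simp [Matrix.blockDiagonal'_apply_eq]
  · rw [Matrix.blockDiagonal'_apply_ne _ _ _ h,
      Matrix.blockDiagonal'_apply_ne _ _ _ (fun h' => h (σ.injective h'))]

theorem similar_jordanMatrix {f : ι → ℕ × F} {g : κ → ℕ × F}
    (h : Finset.univ.val.map f = Finset.univ.val.map g) :
    Similar (jordanMatrix f) (jordanMatrix g) := by
  obtain ⟨σ, hσ⟩ := exists_equiv_of_map_univ_eq h
  have : f = g ∘ σ := funext fun i => (hσ i).symm
  subst this
  exact (similar_jordanMatrix_comp g σ).symm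

/-- Blocks of size zero may be dropped. -/
theorem similar_jordanMatrix_subtype (f : ι → ℕ × F) :
    Similar (jordanMatrix f) (jordanMatrix fun i : {i // 0 < (f i).1} => f i) := by
  let e : (Σ i : {i // 0 < (f i).1}, Fin (f i).1) ≃ (Σ i, Fin (f i).1) :=
    { toFun := fun x => ⟨x.1, x.2⟩
      invFun := fun x => ⟨⟨x.1, x.2.pos⟩, x.2⟩
      left_inv := fun x => rfl
      right_inv := fun x => rfl }
  suffices h : (jordanMatrix fun i : {i // 0 < (f i).1} => f i) =
      (jordanMatrix f).submatrix e e by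
    rw [h]; exact similar_submatrix _ e
  ext ⟨i, x⟩ ⟨j, y⟩
  simp only [jordanMatrix, Matrix.submatrix_apply, e, Equiv.coe_fn_mk]
  by_cases h : i = j
  · subst h
    simp [Matrix.blockDiagonal'_apply_eq]
  · rw [Matrix.blockDiagonal'_apply_ne _ _ _ h,
      Matrix.blockDiagonal'_apply_ne _ _ _ (fun h' => h (Subtype.ext h'))]

/-- Conjugation by `diag(1, -1, 1, ...)` changes the sign of the superdiagonal and keeps the
diagonal, so it undoes the effect of negation on the ones. -/
theorem similar_neg_jordanBlock (m : ℕ) (a : F) :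
    Similar (-jordanBlock m a) (jordanBlock m (-a)) := by
  have hD : (Matrix.diagonal fun i : Fin m => (-1 : F) ^ (i : ℕ)) *
      Matrix.diagonal (fun i : Fin m => (-1 : F) ^ (i : ℕ)) = 1 := by
    rw [Matrix.diagonal_mul_diagonal, ← Matrix.diagonal_one]
    congr 1; ext i
    rw [← pow_add, ← two_mul, pow_mul]; simp
  refine ⟨_, _, hD, hD, ?_⟩
  ext i j
  rw [Matrix.mul_diagonal, Matrix.diagonal_mul]
  simp only [jordanBlock, Matrix.neg_apply, Matrix.of_apply]
  by_cases h : i = j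
  · subst h
    simp only [if_true]
    rcases neg_one_pow_eq_or F (i : ℕ) with h | h <;> rw [h] <;> simp
  · by_cases h' : (i : ℕ) + 1 = j
    · simp [h, ← h', pow_succ]
    · simp [h, h']

theorem similar_neg_jordanMatrix (f : ι → ℕ × F) :
    Similar (-jordanMatrix f) (jordanMatrix fun i => ((f i).1, -(f i).2)) := by
  rw [jordanMatrix, ← Matrix.blockDiagonal'_neg]
  exact Similar.blockDiagonal' fun i => similar_neg_jordanBlock _ _

/-- `s` is the multiset of the sizes and eigenvalues of the blocks of a Jordan form of `X`. -/
def HasJordanType {m : Type*} [Fintype m] [DecidableEq m] (X : Matrix m m F)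
    (s : Multiset (ℕ × F)) : Prop :=
  ∃ (r : ℕ) (f : Fin r → ℕ × F), (∀ i, 0 < (f i).1) ∧ Finset.univ.val.map f = s ∧
    Similar X (jordanMatrix f)

theorem hasJordanType_of_similar {m : Type*} [Fintype m] [DecidableEq m] {X : Matrix m m F}
    {f : ι → ℕ × F} (hf : ∀ i, 0 < (f i).1) (h : Similar X (jordanMatrix f)) :
    HasJordanType X (Finset.univ.val.map f) := by
  refine ⟨Fintype.card ι, f ∘ (Fintype.equivFin ι).symm, fun i => hf _, ?_,
    h.trans (similar_jordanMatrix_comp _ _)⟩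
  rw [← Multiset.map_map, Multiset.map_univ_val_equiv]

theorem HasJordanType.similar {m : Type*} [Fintype m] [DecidableEq m] {X : Matrix m m F}
    {f : ι → ℕ × F} (h : HasJordanType X (Finset.univ.val.map f)) : Similar X (jordanMatrix f) := by
  obtain ⟨r, g, -, hs, hg⟩ := h
  exact hg.trans (similar_jordanMatrix hs)

theorem HasJordanType.pos {m : Type*} [Fintype m] [DecidableEq m] {X : Matrix m m F}
    {s : Multiset (ℕ × F)} (h : HasJordanType X s) : ∀ p ∈ s, 0 < p.1 := by
  obtain ⟨r, f, hf, rfl, -⟩ := h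
  simpa using hf

theorem HasJordanType.of_similar {m n : Type*} [Fintype m] [DecidableEq m] [Fintype n]
    [DecidableEq n] {X : Matrix m m F} {Y : Matrix n n F} {s : Multiset (ℕ × F)}
    (h : HasJordanType X s) (hXY : Similar Y X) : HasJordanType Y s := by
  obtain ⟨r, f, hf, hs, hX⟩ := h
  exact ⟨r, f, hf, hs, hXY.trans hX⟩

theorem HasJordanType.similar_of_same {m n : Type*} [Fintype m] [DecidableEq m] [Fintype n]
    [DecidableEq n] {X : Matrix m m F} {Y : Matrix n n F} {s : Multiset (ℕ × F)}
    (hX : HasJordanType X s) (hY : HasJordanType Y s) : Similar X Y := by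
  obtain ⟨r, f, hf, rfl, h⟩ := hY
  exact hX.similar.trans h.symm

theorem HasJordanType.neg {m : Type*} [Fintype m] [DecidableEq m] {X : Matrix m m F}
    {s : Multiset (ℕ × F)} (h : HasJordanType X s) :
    HasJordanType (-X) (s.map fun p => (p.1, -p.2)) := by
  obtain ⟨r, f, hf, rfl, hX⟩ := h
  exact ⟨r, fun i => ((f i).1, -(f i).2), hf, by rw [Multiset.map_map]; rfl,
    hX.neg.trans (similar_neg_jordanMatrix f)⟩

theorem HasJordanType.map {F' : Type*} [Ring F'] (φ : F →+* F') {m : Type*} [Fintype m]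
    [DecidableEq m] {X : Matrix m m F} {s : Multiset (ℕ × F)} (h : HasJordanType X s) :
    HasJordanType (X.map φ) (s.map fun p => (p.1, φ p.2)) := by
  obtain ⟨r, f, hf, rfl, hX⟩ := h
  exact ⟨r, fun i => ((f i).1, φ (f i).2), hf, by rw [Multiset.map_map]; rfl,
    by rw [← jordanMatrix_map]; exact hX.map φ⟩

/-- The numbering `e` carries no information: similarity forces both index types to have the same
cardinality, and any bijection between them will do. -/
theorem hasJordanForm_iff [InvariantBasisNumber F] {n r : ℕ} (X : Matrix (Fin n) (Fin n) F)
    (d : Fin r → ℕ) (a : Fin r → F) : HasJordanForm X d a ↔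
      (∀ i, 0 < d i) ∧ Similar X (jordanMatrix fun i => (d i, a i)) := by
  refine and_congr_right fun _ => ⟨?_, fun h => ?_⟩
  · rintro ⟨e, hg⟩
    exact (similar_iff_exists_units.2 hg).trans
      (similar_submatrix (jordanMatrix fun i => (d i, a i)) e.symm).symm
  · have e := Fintype.equivOfCardEq h.card_eq
    exact ⟨e.symm, similar_iff_exists_units.1 (h.trans (similar_submatrix _ e))⟩

end JordanMatrix

section

open Polynomial

/-! ### Existence of the Jordan form of a complex matrix -/

theorem jordanBlock_mulVec {F : Type*} [Ring F] (m : ℕ) (a : F) (v : Fin m → F) (k : Fin m) :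
    (jordanBlock m a *ᵥ v) k =
      a * v k + if h : (k : ℕ) + 1 < m then v ⟨k + 1, h⟩ else 0 := by
  simp only [Matrix.mulVec, dotProduct, jordanBlock, Matrix.of_apply]
  have : ∀ j : Fin m, (if k = j then a else if (k : ℕ) + 1 = j then (1 : F) else 0) * v j =
      (if k = j then a * v j else 0) + (if (k : ℕ) + 1 = j then v j else 0) := fun j => by
    by_cases h : k = j
    · subst h; simp
    · by_cases h' : (k : ℕ) + 1 = j <;> simp [h, h']
  simp only [this, Finset.sum_add_distrib, Finset.sum_ite_eq, Finset.mem_univ, if_true]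
  congr 1
  split_ifs with h
  · rw [Finset.sum_eq_single ⟨k + 1, h⟩]
    · simp
    · intro j _ hj
      rw [if_neg fun h' => hj (Fin.ext h'.symm)]
    · simp
  · exact Finset.sum_eq_zero fun j _ => if_neg fun h' => h (by have := j.2; omega)

/-- The first `e` Taylor coefficients at `a` of a polynomial, in reverse order. -/
def taylorCoeffs (a : ℂ) (e : ℕ) : ℂ[X] →ₗ[ℂ] (Fin e → ℂ) where
  toFun f k := (taylor a f).coeff (e - 1 - k)
  map_add' f g := by ext; simp
  map_smul' c f := by ext; simp

theorem taylorCoeffs_surjective (a : ℂ) (e : ℕ) : Function.Surjective (taylorCoeffs a e) := by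
  intro v
  refine ⟨(taylorEquiv a).symm (∑ j : Fin e, monomial (e - 1 - j) (v j)), ?_⟩
  ext k
  change (taylorEquiv a ((taylorEquiv a).symm _)).coeff _ = _
  rw [AlgEquiv.apply_symm_apply, Polynomial.finsetSum_coeff, Finset.sum_eq_single k]
  · simp
  · intro j _ hj
    rw [Polynomial.coeff_monomial, if_neg]
    intro h
    exact hj (Fin.ext (by omega))
  · simp

theorem taylorCoeffs_eq_zero_iff (a : ℂ) (e : ℕ) (f : ℂ[X]) :
    taylorCoeffs a e f = 0 ↔ (X - C a) ^ e ∣ f := by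
  have h1 : (X - C a) ^ e ∣ f ↔ X ^ e ∣ taylor a f := by
    rw [← map_dvd_iff (taylorEquiv a), map_pow, map_sub]
    change ((taylor a X) - taylor a (C a)) ^ e ∣ taylor a f ↔ _
    simp
  rw [h1, Polynomial.X_pow_dvd_iff]
  constructor
  · intro h d hd
    have := congrFun h ⟨e - 1 - d, by omega⟩
    have h2 : e - 1 - (e - 1 - d) = d := by omega
    simpa [taylorCoeffs, h2] using this
  · intro h
    ext k
    exact h _ (by omega)

/-- In the variable centred at `a`, multiplication by `X` becomes multiplication by `X + a`. The
summand `X` moves each coefficient up one degree; the reversed order of the coefficients puts this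
shift on the superdiagonal. -/
theorem taylorCoeffs_X_mul (a : ℂ) (e : ℕ) (f : ℂ[X]) :
    taylorCoeffs a e (X * f) = jordanBlock e a *ᵥ taylorCoeffs a e f := by
  ext k
  rw [jordanBlock_mulVec]
  change (taylor a (X * f)).coeff _ = a * (taylor a f).coeff _ + _
  rw [taylor_mul, taylor_X, add_mul, Polynomial.coeff_add, Polynomial.coeff_C_mul, add_comm]
  congr 1
  split_ifs with h
  · have h2 : e - 1 - (k : ℕ) = (e - 1 - (k + 1)) + 1 := by omega
    rw [h2, Polynomial.coeff_X_mul]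
    rfl
  -- The last coordinate is the constant coefficient, to which a multiple of `X` contributes
  -- nothing.
  · have h2 : e - 1 - (k : ℕ) = 0 := by omega
    rw [h2]; simp

/-- Over ℂ an irreducible `p` is associated to some `X - a`, and the Taylor coefficients at `a` are
coordinates on the quotient by its `e`-th power. -/
theorem exists_linearEquiv_quotient_pow (p : ℂ[X]) (hp : Irreducible p) (e : ℕ) :
    ∃ (a : ℂ) (φ : (ℂ[X] ⧸ Submodule.span ℂ[X] {p ^ e}) ≃ₗ[ℂ] (Fin e → ℂ)),
      ∀ x, φ ((X : ℂ[X]) • x) = jordanBlock e a *ᵥ φ x := by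
  have hdeg := IsAlgClosed.degree_eq_one_of_irreducible ℂ hp
  obtain ⟨a, ha⟩ := IsAlgClosed.exists_root p (by rw [hdeg]; exact one_ne_zero)
  have hass : Associated (X - C a) p :=
    (irreducible_X_sub_C a).associated_of_dvd hp (dvd_iff_isRoot.2 ha)
  have hker : (Submodule.span ℂ[X] {p ^ e}).restrictScalars ℂ =
      LinearMap.ker (taylorCoeffs a e) := by
    ext f
    rw [Submodule.restrictScalars_mem, LinearMap.mem_ker, taylorCoeffs_eq_zero_iff,
      (hass.pow_pow (n := e)).dvd_iff_dvd_left]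
    exact Ideal.mem_span_singleton
  refine ⟨a, (Submodule.Quotient.restrictScalarsEquiv ℂ _).symm.trans
    ((Submodule.quotEquivOfEq _ _ hker).trans
      ((taylorCoeffs a e).quotKerEquivOfSurjective (taylorCoeffs_surjective a e))), fun x => ?_⟩
  obtain ⟨f, rfl⟩ := Submodule.Quotient.mk_surjective _ x
  exact taylorCoeffs_X_mul a e f

theorem blockDiagonal'_mulVec {F ι : Type*} [Ring F] [Fintype ι] [DecidableEq ι] {m : ι → Type*}
    [∀ i, Fintype (m i)] (M : ∀ i, Matrix (m i) (m i) F) (v : (Σ i, m i) → F) (i : ι) (k : m i) :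
    (Matrix.blockDiagonal' M *ᵥ v) ⟨i, k⟩ = (M i *ᵥ fun j => v ⟨i, j⟩) k := by
  simp only [Matrix.mulVec, dotProduct, Fintype.sum_sigma]
  rw [Finset.sum_eq_single i]
  · simp [Matrix.blockDiagonal'_apply_eq]
  · intro j _ hj
    exact Finset.sum_eq_zero fun x _ => by
      rw [Matrix.blockDiagonal'_apply_ne _ _ _ hj.symm, zero_mul]
  · simp

theorem similar_of_linearEquiv {F m n : Type*} [CommRing F] [Fintype m] [DecidableEq m] [Fintype n]
    [DecidableEq n] {A : Matrix m m F} {B : Matrix n n F} (φ : (m → F) ≃ₗ[F] (n → F))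
    (h : ∀ v, φ (A *ᵥ v) = B *ᵥ φ v) : Similar A B := by
  refine Similar.symm ⟨LinearMap.toMatrix' φ.toLinearMap, LinearMap.toMatrix' φ.symm.toLinearMap,
    ?_, ?_, ?_⟩
  · rw [← LinearMap.toMatrix'_comp]; simp
  · rw [← LinearMap.toMatrix'_comp]; simp
  · apply Matrix.toLin'.injective
    refine LinearMap.ext fun v => ?_
    simp [Matrix.toLin'_mul, h]

/-- The matrix makes `ℂ^m` a torsion `ℂ[X]`-module; the structure theorem over a PID splits it into
quotients by prime powers, each giving one Jordan block. -/
theorem exists_hasJordanType {m : Type*} [Fintype m] [DecidableEq m] (A : Matrix m m ℂ) :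
    ∃ s, HasJordanType A s := by
  classical
  let T := Matrix.toLin' A
  obtain ⟨ι, _, p, hp, e, ⟨g⟩⟩ := Module.equiv_directSum_of_isTorsion
    (Module.AEval.isTorsion_of_finiteDimensional ℂ (m → ℂ) T)
  choose a φ hφ using fun i => exists_linearEquiv_quotient_pow (p i) (hp i) (e i)
  let f : ι → ℕ × ℂ := fun i => (e i, a i)
  let g' := (g.trans (DirectSum.linearEquivFunOnFintype ℂ[X] ι _)).restrictScalars ℂ
  let ψ : (m → ℂ) ≃ₗ[ℂ] ((Σ i, Fin (e i)) → ℂ) :=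
    (Module.AEval.of ℂ (m → ℂ) T).trans (g'.trans ((LinearEquiv.piCongrRight φ).trans
      (LinearEquiv.piCurry ℂ fun _ _ => ℂ).symm))
  have hψ : ∀ v, ψ (A *ᵥ v) = jordanMatrix f *ᵥ ψ v := by
    intro v
    ext ⟨i, k⟩
    rw [jordanMatrix, blockDiagonal'_mulVec]
    change φ i (g (Module.AEval.of ℂ (m → ℂ) T (A *ᵥ v)) i) k =
      (jordanBlock (e i) (a i) *ᵥ (φ i (g (Module.AEval.of ℂ (m → ℂ) T v) i))) k
    rw [← hφ]
    have : Module.AEval.of ℂ (m → ℂ) T (A *ᵥ v) =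
        (X : ℂ[X]) • Module.AEval.of ℂ (m → ℂ) T v :=
      (Module.AEval.X_smul_of (a := T) v).symm
    rw [this, map_smul]
    rfl
  -- The exponents `e i` may be zero, so empty blocks are discarded.
  exact ⟨_, hasJordanType_of_similar (fun i => i.2)
    ((similar_of_linearEquiv ψ hψ).trans (similar_jordanMatrix_subtype f))⟩

end

/-! ### Uniqueness of the Jordan form of a complex matrix -/

/-- The dimension of the kernel of a complex matrix. -/
def nullity {m : Type*} [Fintype m] [DecidableEq m] (A : Matrix m m ℂ) : ℕ :=
  Module.finrank ℂ (LinearMap.ker (Matrix.toLin' A))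

theorem rank_add_nullity {m : Type*} [Fintype m] [DecidableEq m] (A : Matrix m m ℂ) :
    A.rank + nullity A = Fintype.card m := by
  rw [nullity, Matrix.rank, ← Matrix.toLin'_apply', LinearMap.finrank_range_add_finrank_ker,
    Module.finrank_fintype_fun_eq_card]

section

variable {m n : Type*} [Fintype m] [DecidableEq m] [Fintype n] [DecidableEq n]

theorem Similar.rank_le {A : Matrix m m ℂ} {B : Matrix n n ℂ} : Similar A B → A.rank ≤ B.rank := by
  rintro ⟨P, Q, h1, h2, h⟩
  have : A = P * (B * Q) := by
    rw [← Matrix.mul_assoc, ← h, Matrix.mul_assoc, h1, Matrix.mul_one]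
  rw [this]
  exact (Matrix.rank_mul_le_right _ _).trans (Matrix.rank_mul_le_left _ _)

theorem Similar.nullity_eq {A : Matrix m m ℂ} {B : Matrix n n ℂ} (h : Similar A B) :
    nullity A = nullity B := by
  have h1 := rank_add_nullity A
  have h2 := rank_add_nullity B
  have h3 := h.card_eq
  have h4 := h.rank_le
  have h5 := h.symm.rank_le
  omega

theorem Similar.sub_smul_one {F : Type*} [CommRing F] {A : Matrix m m F} {B : Matrix n n F}
    (l : F) : Similar A B → Similar (A - l • 1) (B - l • 1) := by
  rintro ⟨P, Q, h1, h2, h⟩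
  exact ⟨P, Q, h1, h2, by simp [Matrix.sub_mul, Matrix.mul_sub, h]⟩

end

theorem nullity_blockDiagonal' {ι : Type*} [Fintype ι] [DecidableEq ι] {m : ι → Type*}
    [∀ i, Fintype (m i)] [∀ i, DecidableEq (m i)] (M : ∀ i, Matrix (m i) (m i) ℂ) :
    nullity (Matrix.blockDiagonal' M) = ∑ i, nullity (M i) := by
  have hmem : ∀ v, v ∈ LinearMap.ker (Matrix.toLin' (Matrix.blockDiagonal' M)) ↔
      ∀ i, (fun j => v ⟨i, j⟩) ∈ LinearMap.ker (Matrix.toLin' (M i)) := fun v => by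
    simp only [LinearMap.mem_ker, Matrix.toLin'_apply]
    refine ⟨fun h i => ?_, fun h => ?_⟩
    · ext k
      rw [← blockDiagonal'_mulVec, h]; rfl
    · ext ⟨i, k⟩
      rw [blockDiagonal'_mulVec, h]; rfl
  let e : LinearMap.ker (Matrix.toLin' (Matrix.blockDiagonal' M)) ≃ₗ[ℂ]
      (∀ i, LinearMap.ker (Matrix.toLin' (M i))) :=
    { toFun := fun v i => ⟨fun j => v.1 ⟨i, j⟩, (hmem v.1).1 v.2 i⟩
      invFun := fun w => ⟨fun x => (w x.1).1 x.2, (hmem _).2 fun i => (w i).2⟩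
      map_add' := fun v w => rfl
      map_smul' := fun c v => rfl
      left_inv := fun v => rfl
      right_inv := fun w => rfl }
  rw [nullity, e.finrank_eq, Module.finrank_pi_fintype]
  rfl

theorem jordanBlock_sub_smul_one (d : ℕ) (a l : ℂ) :
    jordanBlock d a - l • 1 = jordanBlock d (a - l) := by
  ext i j
  by_cases h : i = j
  · subst h; simp [jordanBlock]
  · simp [jordanBlock, h]

theorem jordanBlock_zero_pow_mulVec (d k : ℕ) (v : Fin d → ℂ) (j : Fin d) :
    ((jordanBlock d (0 : ℂ)) ^ k *ᵥ v) j =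
      if h : (j : ℕ) + k < d then v ⟨j + k, h⟩ else 0 := by
  induction k generalizing v j with
  | zero => simp
  | succ k ih =>
    rw [pow_succ, ← Matrix.mulVec_mulVec, ih]
    by_cases h : (j : ℕ) + k < d
    · rw [dif_pos h, jordanBlock_mulVec, zero_mul, zero_add]
      rfl
    · rw [dif_neg h, dif_neg (by omega)]

/-- The `k`-th power shifts coordinates by `k`, so its kernel consists of the vectors supported on
the first `k` coordinates. -/
theorem nullity_jordanBlock_zero_pow (d k : ℕ) :
    nullity ((jordanBlock d (0 : ℂ)) ^ k) = min k d := by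
  have hmem : ∀ v, v ∈ LinearMap.ker (Matrix.toLin' ((jordanBlock d (0 : ℂ)) ^ k)) ↔
      ∀ j : Fin d, k ≤ (j : ℕ) → v j = 0 := fun v => by
    rw [LinearMap.mem_ker, Matrix.toLin'_apply]
    refine ⟨fun h j hj => ?_, fun h => ?_⟩
    · have := congrFun h ⟨j - k, by omega⟩
      rw [jordanBlock_zero_pow_mulVec, dif_pos (by simp; omega)] at this
      simpa [Nat.sub_add_cancel hj] using this
    · ext j
      rw [jordanBlock_zero_pow_mulVec]
      split_ifs with h'
      · exact h _ (by simp)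
      · rfl
  let e : LinearMap.ker (Matrix.toLin' ((jordanBlock d (0 : ℂ)) ^ k)) ≃ₗ[ℂ]
      (Fin (min k d) → ℂ) :=
    { toFun := fun v i => v.1 (Fin.castLE (min_le_right k d) i)
      invFun := fun w => ⟨fun j => if h : (j : ℕ) < k then w ⟨j, by omega⟩ else 0,
        (hmem _).2 fun j hj => dif_neg (by omega)⟩
      map_add' := fun v w => rfl
      map_smul' := fun c v => rfl
      left_inv := fun v => by
        ext j
        simp only
        split_ifs with h
        · rfl
        · exact ((hmem _).1 v.2 j (by omega)).symm
      right_inv := fun w => by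
        ext i
        have := i.2
        simp only [Fin.val_castLE]
        rw [dif_pos (by omega)] }
  rw [nullity, e.finrank_eq, Module.finrank_fintype_fun_eq_card, Fintype.card_fin]

theorem nullity_jordanBlock_pow {d : ℕ} {b : ℂ} (hb : b ≠ 0) (k : ℕ) :
    nullity ((jordanBlock d b) ^ k) = 0 := by
  have hdet : (jordanBlock d b).det = b ^ d := by
    rw [Matrix.det_of_isUpperTriangular]
    · simp [jordanBlock]
    · intro i j hij
      have : j < i := hij
      have h1 : i ≠ j := this.ne'
      have h2 : (i : ℕ) + 1 ≠ j := by
        have : (j : ℕ) < i := this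
        omega
      simp [jordanBlock, h1, h2]
  have hu : IsUnit ((jordanBlock d b) ^ k) := by
    rw [Matrix.isUnit_iff_isUnit_det, Matrix.det_pow, hdet]
    exact (((isUnit_iff_ne_zero.2 hb).pow d).pow k)
  have := rank_add_nullity ((jordanBlock d b) ^ k)
  rw [Matrix.rank_of_isUnit _ hu] at this
  omega

/-- The multiset of the sizes of the blocks with eigenvalue `l`. -/
def sizes (s : Multiset (ℕ × ℂ)) (l : ℂ) : Multiset ℕ := (s.filter fun p => p.2 = l).map Prod.fst

theorem count_sizes (s : Multiset (ℕ × ℂ)) (l : ℂ) (d : ℕ) :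
    (sizes s l).count d = s.count (d, l) := by
  rw [sizes, Multiset.count_map, Multiset.count_eq_card_filter_eq, Multiset.filter_filter]
  congr 1
  refine Multiset.filter_congr fun p _ => ?_
  rw [Prod.ext_iff, eq_comm (a := p.2)]

theorem eq_of_sizes_eq {s t : Multiset (ℕ × ℂ)} (h : ∀ l, sizes s l = sizes t l) : s = t := by
  ext ⟨d, l⟩
  rw [← count_sizes, ← count_sizes, h]

/-- Blocks with an eigenvalue other than `l` stay invertible; a block of size `d` at `l` becomes
nilpotent and contributes `min k d`. -/
theorem nullity_pow_eq_sum {m : Type*} [Fintype m] [DecidableEq m] {A : Matrix m m ℂ}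
    {s : Multiset (ℕ × ℂ)} (h : HasJordanType A s) (l : ℂ) (k : ℕ) :
    nullity ((A - l • 1) ^ k) = ((sizes s l).map (min k)).sum := by
  obtain ⟨r, f, hf, rfl, hA⟩ := h
  rw [((hA.sub_smul_one l).pow k).nullity_eq]
  have h1 : (jordanMatrix f - l • 1) ^ k =
      Matrix.blockDiagonal' fun i => jordanBlock (f i).1 ((f i).2 - l) ^ k := by
    rw [show (fun i => jordanBlock (f i).1 ((f i).2 - l) ^ k) =
      (fun i => jordanBlock (f i).1 ((f i).2 - l)) ^ k from rfl, Matrix.blockDiagonal'_pow]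
    congr 1
    rw [jordanMatrix, ← Matrix.blockDiagonal'_one, ← Matrix.blockDiagonal'_smul,
      ← Matrix.blockDiagonal'_sub]
    congr 1
    ext1 i
    exact jordanBlock_sub_smul_one _ _ _
  rw [h1, nullity_blockDiagonal', sizes, Multiset.map_map, Multiset.filter_map, Multiset.map_map]
  change _ = ((Finset.univ.filter fun i => (f i).2 = l).val.map fun i => min k (f i).1).sum
  rw [← Finset.sum_eq_multiset_sum, Finset.sum_filter]
  refine Finset.sum_congr rfl fun i _ => ?_
  split_ifs with h
  · rw [h, sub_self, nullity_jordanBlock_zero_pow]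
  · exact nullity_jordanBlock_pow (sub_ne_zero.2 h) k

/-- The second difference of `k ↦ min k x` vanishes except at `x`, where it is `-1`. Thus the
nullities of powers count the blocks of each positive size. -/
theorem sum_map_min_add (u : Multiset ℕ) (k : ℕ) :
    (u.map (min (k + 2))).sum + (u.map (min k)).sum + u.count (k + 1) =
      2 * (u.map (min (k + 1))).sum := by
  induction u using Multiset.induction_on with
  | empty => simp
  | cons x u ih =>
    simp only [Multiset.map_cons, Multiset.sum_cons, Multiset.count_cons]
    split_ifs <;> omega

theorem eq_of_sum_map_min_eq {u v : Multiset ℕ} (hu : ∀ x ∈ u, 0 < x) (hv : ∀ x ∈ v, 0 < x)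
    (h : ∀ k, (u.map (min k)).sum = (v.map (min k)).sum) : u = v := by
  ext k
  rcases k with _ | k
  · rw [Multiset.count_eq_zero_of_notMem fun h => (hu 0 h).false,
      Multiset.count_eq_zero_of_notMem fun h => (hv 0 h).false]
  · have h1 := sum_map_min_add u k
    have h2 := sum_map_min_add v k
    rw [h, h, h] at h1
    omega

theorem pos_of_mem_sizes {s : Multiset (ℕ × ℂ)} (hs : ∀ p ∈ s, 0 < p.1) {l : ℂ} :
    ∀ x ∈ sizes s l, 0 < x := by
  intro x hx
  obtain ⟨p, hp, rfl⟩ := Multiset.mem_map.1 hx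
  exact hs p (Multiset.mem_of_mem_filter hp)

theorem HasJordanType.unique {m : Type*} [Fintype m] [DecidableEq m] {A : Matrix m m ℂ}
    {s t : Multiset (ℕ × ℂ)} (hs : HasJordanType A s) (ht : HasJordanType A t) : s = t :=
  eq_of_sizes_eq fun l => eq_of_sum_map_min_eq (pos_of_mem_sizes hs.pos) (pos_of_mem_sizes ht.pos)
    fun k => by rw [← nullity_pow_eq_sum hs, ← nullity_pow_eq_sum ht]

theorem ker_pow_eq {m : Type*} [Fintype m] [DecidableEq m] (A : Matrix m m ℂ) (l : ℂ) (k : ℕ) :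
    Module.End.genEigenspace (Matrix.toLin' A) l k =
      LinearMap.ker (Matrix.toLin' ((A - l • 1) ^ k)) := by
  rw [Module.End.genEigenspace_nat, Matrix.toLin'_pow, map_sub, map_smul, Matrix.toLin'_one]
  rfl

theorem sum_map_min_of_le {u : Multiset ℕ} {N : ℕ} (h : ∀ x ∈ u, x ≤ N) :
    (u.map (min N)).sum = u.sum := by
  conv_rhs => rw [← Multiset.map_id u]
  exact congrArg Multiset.sum (Multiset.map_congr rfl fun x hx => min_eq_right (h x hx))

theorem rootMultiplicity_charpoly {m : Type*} [Fintype m] [DecidableEq m] {A : Matrix m m ℂ}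
    {s : Multiset (ℕ × ℂ)} (h : HasJordanType A s) (l : ℂ) :
    A.charpoly.rootMultiplicity l = (sizes s l).sum := by
  -- This exponent is at least the dimension, so the generalized eigenspace has stabilized, and at
  -- least every block size, so each `min k d` is `d`.
  set k := max (Fintype.card m) (sizes s l).sum with hk
  rw [← Matrix.charpoly_toLin', ← LinearMap.finrank_maxGenEigenspace_eq,
    Module.End.maxGenEigenspace_eq_genEigenspace_finrank,
    ← Module.End.genEigenspace_eq_genEigenspace_finrank_of_le (k := k)
      (Matrix.toLin' A) l (by rw [Module.finrank_fintype_fun_eq_card]; exact le_max_left _ _),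
    ker_pow_eq]
  change nullity _ = _
  rw [nullity_pow_eq_sum h, sum_map_min_of_le]
  exact fun x hx => (Multiset.le_sum_of_mem hx).trans (le_max_right _ _)

theorem hasEigenvalue_iff_sizes_ne_zero {m : Type*} [Fintype m] [DecidableEq m] {A : Matrix m m ℂ}
    {s : Multiset (ℕ × ℂ)} (h : HasJordanType A s) (l : ℂ) :
    Module.End.HasEigenvalue (Matrix.toLin' A) l ↔ sizes s l ≠ 0 := by
  rw [Module.End.hasEigenvalue_iff_isRoot_charpoly, Matrix.charpoly_toLin',
    ← Polynomial.rootMultiplicity_pos (Matrix.charpoly_monic A).ne_zero,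
    rootMultiplicity_charpoly h, pos_iff_ne_zero, Ne, not_iff_not]
  constructor
  · intro h0
    refine Multiset.eq_zero_of_forall_notMem fun x hx => ?_
    have := Multiset.le_sum_of_mem hx
    have := pos_of_mem_sizes h.pos x hx
    omega
  · intro h0; rw [h0]; rfl

/-! ### Complex matrices attached to quaternionic matrices -/

/-- The embedding `Φ` for rectangular quaternionic matrices. -/
def complexify {m n : Type*} (A : Matrix m n ℍ[ℝ]) : Matrix (m ⊕ m) (n ⊕ n) ℂ :=
  Matrix.fromBlocks (A.map fstPart) (A.map sndPart)
    (-(A.map fun q => starRingEnd ℂ (sndPart q))) (A.map fun q => starRingEnd ℂ (fstPart q))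

section

variable {l m n : Type*} [Fintype l] [DecidableEq l] [Fintype m] [DecidableEq m] [Fintype n]
  [DecidableEq n]

theorem complexify_mul {l m n : Type*} [Fintype m] (A : Matrix l m ℍ[ℝ]) (B : Matrix m n ℍ[ℝ]) :
    complexify (A * B) = complexify A * complexify B := by
  rw [complexify, complexify, complexify, Matrix.fromBlocks_multiply]
  congr 1 <;> ext i j : 1 <;>
    simp only [Matrix.map_apply, Matrix.mul_apply, Matrix.add_apply, Matrix.neg_apply,
      fstPart_sum, sndPart_sum, fstPart_mul, sndPart_mul, map_sum, map_add, map_sub, map_mul,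
      Complex.conj_conj, Finset.sum_add_distrib, Finset.sum_sub_distrib, mul_neg, neg_mul,
      Finset.sum_neg_distrib] <;> ring

theorem complexify_one {n : Type*} [DecidableEq n] :
    complexify (1 : Matrix n n ℍ[ℝ]) = 1 := by
  have h1 : fstPart 1 = 1 := rfl
  have h2 : sndPart 1 = 0 := rfl
  have h3 : fstPart 0 = 0 := rfl
  have h4 : sndPart 0 = 0 := rfl
  rw [complexify, ← Matrix.fromBlocks_one]
  congr 1 <;> ext i j : 1 <;> by_cases h : i = j <;> simp [Matrix.one_apply, h, h1, h2, h3, h4]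

theorem fstPart_sndPart_ext {p q : ℍ[ℝ]} (h1 : fstPart p = fstPart q)
    (h2 : sndPart p = sndPart q) : p = q := by
  simp only [fstPart, sndPart, Complex.mk.injEq] at h1 h2
  ext
  exacts [h1.1, h1.2, h2.1, h2.2]

theorem complexify_injective {m n : Type*} :
    Function.Injective (complexify : Matrix m n ℍ[ℝ] → _) := by
  intro A B h
  obtain ⟨h1, h2, -, -⟩ := Matrix.fromBlocks_inj.1 h
  ext1 i j
  exact fstPart_sndPart_ext (congrFun (congrFun h1 i) j) (congrFun (congrFun h2 i) j)

theorem Similar.complexify {A : Matrix m m ℍ[ℝ]} {B : Matrix n n ℍ[ℝ]} :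
    Similar A B → Similar (complexify A) (complexify B) := by
  rintro ⟨P, Q, h1, h2, h⟩
  refine ⟨AdReal.complexify P, AdReal.complexify Q, ?_, ?_, ?_⟩
  · rw [← complexify_mul, h1, complexify_one]
  · rw [← complexify_mul, h2, complexify_one]
  · rw [← complexify_mul, h, complexify_mul]

/-- The matrix of the quaternionic structure of `ℂ²ⁿ`. -/
def structureMatrix (n : Type*) [DecidableEq n] : Matrix (n ⊕ n) (n ⊕ n) ℂ :=
  Matrix.fromBlocks 0 1 (-1) 0

theorem structureMatrix_mul_self : structureMatrix n * structureMatrix n = -1 := by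
  rw [structureMatrix, Matrix.fromBlocks_multiply, ← Matrix.fromBlocks_one, Matrix.fromBlocks_neg]
  simp

theorem structureMatrix_map_conj {n : Type*} [DecidableEq n] :
    (structureMatrix n).map (starRingEnd ℂ) = structureMatrix n := by
  rw [structureMatrix, Matrix.fromBlocks_map]
  congr 1 <;> ext i j <;> simp [Matrix.one_apply, apply_ite]

/-- `M` commutes with the quaternionic structure. -/
def IsQuaternionic (M : Matrix (n ⊕ n) (n ⊕ n) ℂ) : Prop :=
  structureMatrix n * M.map (starRingEnd ℂ) = M * structureMatrix n

theorem isQuaternionic_complexify (A : Matrix n n ℍ[ℝ]) : IsQuaternionic (complexify A) := by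
  rw [IsQuaternionic, structureMatrix, complexify, Matrix.fromBlocks_map,
    Matrix.fromBlocks_multiply, Matrix.fromBlocks_multiply]
  congr 1 <;> ext i j <;> simp

/-- Commuting with the antilinear map `v ↦ J conj v` forces the second row of blocks to be the one
that Φ builds from the first. -/
theorem IsQuaternionic.exists_complexify_eq {M : Matrix (n ⊕ n) (n ⊕ n) ℂ}
    (h : IsQuaternionic M) : ∃ A : Matrix n n ℍ[ℝ], complexify A = M := by
  obtain ⟨a, b, c, d, rfl⟩ : ∃ a b c d, M = Matrix.fromBlocks a b c d :=
    ⟨_, _, _, _, (Matrix.fromBlocks_toBlocks M).symm⟩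
  rw [IsQuaternionic, structureMatrix, Matrix.fromBlocks_map,
    Matrix.fromBlocks_multiply, Matrix.fromBlocks_multiply] at h
  obtain ⟨h1, h2, -, -⟩ := Matrix.fromBlocks_inj.1 h
  refine ⟨Matrix.of fun i j => ⟨(a i j).re, (a i j).im, (b i j).re, (b i j).im⟩, ?_⟩
  rw [complexify]
  congr 1
  · ext i j
    have := congrFun (congrFun h1 i) j
    simp only [Matrix.zero_mul, Matrix.one_mul, zero_add, Matrix.mul_zero, Matrix.mul_neg,
      Matrix.mul_one, Matrix.map_apply, Matrix.neg_apply] at this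
    have h3 : c i j = -starRingEnd ℂ (b i j) := by
      rw [← Complex.conj_conj (c i j), this, map_neg]
    rw [h3]; rfl
  · ext i j
    have := congrFun (congrFun h2 i) j
    simp only [Matrix.zero_mul, Matrix.one_mul, zero_add, add_zero, Matrix.mul_zero,
      Matrix.mul_one, Matrix.map_apply] at this
    have h3 : d i j = starRingEnd ℂ (a i j) := by
      rw [← Complex.conj_conj (d i j), this]
    rw [h3]; rfl

theorem IsQuaternionic.mul {M N : Matrix (n ⊕ n) (n ⊕ n) ℂ} (hM : IsQuaternionic M)
    (hN : IsQuaternionic N) : IsQuaternionic (M * N) := by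
  rw [IsQuaternionic] at *
  rw [Matrix.map_mul, ← Matrix.mul_assoc, hM, Matrix.mul_assoc, hN, Matrix.mul_assoc]

theorem IsQuaternionic.add {M N : Matrix (n ⊕ n) (n ⊕ n) ℂ} (hM : IsQuaternionic M)
    (hN : IsQuaternionic N) : IsQuaternionic (M + N) := by
  rw [IsQuaternionic] at *
  rw [Matrix.map_add _ (map_add _), Matrix.mul_add, Matrix.add_mul, hM, hN]

theorem map_conj_smul {m n : Type*} (z : ℂ) (M : Matrix m n ℂ) :
    (z • M).map (starRingEnd ℂ) = starRingEnd ℂ z • M.map (starRingEnd ℂ) := by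
  ext; simp

theorem IsQuaternionic.smul {M : Matrix (n ⊕ n) (n ⊕ n) ℂ} (hM : IsQuaternionic M) (x : ℝ) :
    IsQuaternionic ((x : ℂ) • M) := by
  rw [IsQuaternionic] at *
  rw [map_conj_smul, Complex.conj_ofReal, Matrix.mul_smul,
    Matrix.smul_mul, hM]

theorem isQuaternionic_one : IsQuaternionic (1 : Matrix (n ⊕ n) (n ⊕ n) ℂ) := by
  rw [← complexify_one]; exact isQuaternionic_complexify 1

theorem IsQuaternionic.pow {M : Matrix (n ⊕ n) (n ⊕ n) ℂ} (hM : IsQuaternionic M) (k : ℕ) :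
    IsQuaternionic (M ^ k) := by
  induction k with
  | zero => exact isQuaternionic_one
  | succ k ih => rw [pow_succ]; exact ih.mul hM

theorem IsQuaternionic.mul_eq_one {M N : Matrix (n ⊕ n) (n ⊕ n) ℂ} (hM : IsQuaternionic M)
    (h : M * N = 1) : IsQuaternionic N := by
  have h' : N * M = 1 := mul_eq_one_comm.1 h
  rw [IsQuaternionic] at *
  have h1 : M.map (starRingEnd ℂ) * N.map (starRingEnd ℂ) = 1 := by
    rw [← Matrix.map_mul, h, Matrix.map_one _ (map_zero _) (map_one _)]
  calc structureMatrix n * N.map (starRingEnd ℂ)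
      = N * (M * structureMatrix n) * N.map (starRingEnd ℂ) := by
        rw [← Matrix.mul_assoc, h', Matrix.one_mul]
    _ = N * structureMatrix n := by
        rw [← hM, Matrix.mul_assoc, Matrix.mul_assoc, h1, Matrix.mul_one]

/-! ### Quaternionic matrices which are similar over `ℂ` -/

/-- The determinant is a polynomial in the parameter, not identically zero, so its finitely many
roots do not exhaust ℝ. -/
theorem exists_real_det_ne_zero (A B : Matrix n n ℂ) (z : ℂ) (h : (A + z • B).det ≠ 0) :
    ∃ x : ℝ, (A + (x : ℂ) • B).det ≠ 0 := by
  let q : Polynomial ℂ :=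
    (A.map Polynomial.C + (Polynomial.X : Polynomial ℂ) • B.map Polynomial.C).det
  have hq : ∀ w, q.eval w = (A + w • B).det := fun w => by
    rw [← Polynomial.coe_evalRingHom, RingHom.map_det]
    congr 1
    ext i j
    simpa using mul_comm _ _
  have hq0 : q ≠ 0 := fun h0 => h (by rw [← hq, h0, Polynomial.eval_zero])
  obtain ⟨x, hx⟩ := (Set.infinite_univ (α := ℝ)).exists_notMem_finset
    (q.roots.toFinset.preimage (fun x : ℝ => (x : ℂ)) Complex.ofReal_injective.injOn)
  refine ⟨x, fun h0 => hx.2 ?_⟩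
  rw [Finset.mem_preimage, Multiset.mem_toFinset, Polynomial.mem_roots hq0, Polynomial.IsRoot, hq,
    h0]

/-- If `P` intertwines the complexifications, so does `P' = J conj(P) J⁻¹`. The combinations `R = P
+ P'` and `S = i(P - P')` are quaternionic intertwiners, and so is `R + xS` for real `x`. Some real
`x` makes it invertible, and the result descends to ℍ. -/
theorem similar_of_similar_complexify_aux {A B : Matrix n n ℍ[ℝ]}
    (h : Similar (complexify A) (complexify B)) : Similar A B := by
  obtain ⟨P, Q, h1, h2, h3⟩ := h
  have hA := isQuaternionic_complexify A
  have hB := isQuaternionic_complexify B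
  set J := structureMatrix n with hJ
  have hJJ : J * J = -1 := structureMatrix_mul_self
  set P' : Matrix (n ⊕ n) (n ⊕ n) ℂ := -(J * P.map (starRingEnd ℂ) * J) with hP'
  have hconj : P'.map (starRingEnd ℂ) = -(J * P * J) := by
    rw [hP', Matrix.map_neg _ (map_neg _), Matrix.map_mul, Matrix.map_mul, hJ,
      structureMatrix_map_conj]
    congr 3
    ext i j; simp
  have hPJ : P' * J = J * P.map (starRingEnd ℂ) := by
    rw [hP', Matrix.neg_mul, Matrix.mul_assoc, hJJ]; simp
  have hJP : J * P'.map (starRingEnd ℂ) = P * J := by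
    rw [hconj, Matrix.mul_neg, Matrix.mul_assoc, ← Matrix.mul_assoc J J, hJJ]; simp
  have h3' : complexify A * P' = P' * complexify B := by
    have h4 := congrArg (fun M => M.map (starRingEnd ℂ)) h3
    simp only [Matrix.map_mul] at h4
    rw [IsQuaternionic] at hA hB
    -- Multiplying `hB` by `J` on both sides moves `J` to the other side of each factor, because `J²
    -- = -1`.
    have hB' : (complexify B).map (starRingEnd ℂ) * J = J * complexify B := by
      have := congrArg (fun M => -(J * M * J)) hB
      simp only [← hJ] at this
      rw [← Matrix.mul_assoc, hJJ, Matrix.mul_assoc J, Matrix.mul_assoc _ J J, hJJ] at this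
      simpa using this
    rw [hP', Matrix.mul_neg, Matrix.neg_mul, ← Matrix.mul_assoc, ← Matrix.mul_assoc, ← hA,
      Matrix.mul_assoc J, h4, Matrix.mul_assoc, Matrix.mul_assoc, hB', Matrix.mul_assoc,
      Matrix.mul_assoc]
  let R := P + P'
  let S := Complex.I • (P - P')
  have hR : IsQuaternionic R := by
    rw [IsQuaternionic, Matrix.map_add _ (map_add _), Matrix.mul_add, Matrix.add_mul, hPJ, ← hJ,
      hJP, add_comm]
  have hS : IsQuaternionic S := by
    rw [IsQuaternionic, show S = Complex.I • (P - P') from rfl, map_conj_smul,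
      Matrix.map_sub _ (map_sub _), Complex.conj_I, Matrix.mul_smul, Matrix.mul_sub,
      Matrix.smul_mul, Matrix.sub_mul, hPJ, ← hJ, hJP]
    module
  have hRS : R + (-Complex.I) • S = (2 : ℂ) • P := by
    simp only [R, S, smul_smul]
    rw [neg_mul, Complex.I_mul_I, neg_neg, one_smul, two_smul]
    abel
  -- At the parameter `-i` the pencil equals `2P`, which is invertible.
  obtain ⟨x, hx⟩ := exists_real_det_ne_zero R S (-Complex.I) (by
    rw [hRS, Matrix.det_smul]
    have := congrArg Matrix.det h1
    rw [Matrix.det_mul, Matrix.det_one] at this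
    exact mul_ne_zero (pow_ne_zero _ two_ne_zero) (left_ne_zero_of_mul_eq_one this))
  have hM : IsQuaternionic (R + (x : ℂ) • S) := hR.add (hS.smul x)
  have hMinv := Matrix.mul_nonsing_inv _ (isUnit_iff_ne_zero.2 hx)
  obtain ⟨U, hU⟩ := hM.exists_complexify_eq
  obtain ⟨V, hV⟩ := (hM.mul_eq_one hMinv).exists_complexify_eq
  rw [← hV, ← hU] at hMinv
  refine ⟨U, V, complexify_injective ?_, complexify_injective ?_, complexify_injective ?_⟩
  · rw [complexify_mul, hMinv, complexify_one]
  · rw [complexify_mul, mul_eq_one_comm.1 hMinv, complexify_one]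
  · rw [complexify_mul, complexify_mul, hU]
    simp only [R, S, Matrix.mul_add, Matrix.add_mul, Matrix.mul_smul, Matrix.smul_mul,
      Matrix.mul_sub, Matrix.sub_mul, h3, h3']

theorem similar_of_similar_complexify {A : Matrix m m ℍ[ℝ]} {B : Matrix n n ℍ[ℝ]}
    (h : Similar (complexify A) (complexify B)) : Similar A B := by
  have hc : Fintype.card m = Fintype.card n := by
    have := h.card_eq
    simp only [Fintype.card_sum] at this
    omega
  have hB := similar_submatrix B (Fintype.equivOfCardEq hc)
  exact (similar_of_similar_complexify_aux (h.trans hB.complexify)).trans hB.symm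

/-! ### The kernels of quaternionic matrices -/

/-- Row vectors killed by `A` form a left ℍ-space, identified over ℝ with the kernel of the
transpose of Φ(A). Comparing real dimensions, the complex dimension is twice the quaternionic one;
transposing preserves the nullity. -/
theorem even_nullity_complexify (A : Matrix n n ℍ[ℝ]) : Even (nullity (complexify A)) := by
  let K := LinearMap.ker (Matrix.toLin' (complexify A)ᵀ)
  let W := LinearMap.ker (Matrix.toLinearMapRight' A)
  have hfst : ∀ (v : n → ℍ[ℝ]) j, fstPart ((v ᵥ* A) j) =
      ((fun x : n ⊕ n => Sum.elim (fun i => fstPart (v i)) (fun i => sndPart (v i)) x) ᵥ*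
        complexify A) (Sum.inl j) := fun v j => by
    simp [Matrix.vecMul, dotProduct, fstPart_sum, fstPart_mul, complexify, sub_eq_add_neg,
      Finset.sum_add_distrib]
  have hsnd : ∀ (v : n → ℍ[ℝ]) j, sndPart ((v ᵥ* A) j) =
      ((fun x : n ⊕ n => Sum.elim (fun i => fstPart (v i)) (fun i => sndPart (v i)) x) ᵥ*
        complexify A) (Sum.inr j) := fun v j => by
    simp [Matrix.vecMul, dotProduct, sndPart_sum, sndPart_mul, complexify,
      Finset.sum_add_distrib]
  have hmem : ∀ v : n → ℍ[ℝ], v ∈ W ↔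
      (fun x : n ⊕ n => Sum.elim (fun i => fstPart (v i)) (fun i => sndPart (v i)) x) ∈ K := by
    intro v
    rw [LinearMap.mem_ker, LinearMap.mem_ker, Matrix.toLin'_apply, Matrix.mulVec_transpose,
      Matrix.toLinearMapRight'_apply]
    constructor
    · intro h
      ext (j | j)
      · rw [← hfst, h]; rfl
      · rw [← hsnd, h]; rfl
    · intro h
      ext1 j
      exact fstPart_sndPart_ext (by rw [hfst, h]; rfl) (by rw [hsnd, h]; rfl)
  let e : W ≃ₗ[ℝ] K :=
    { toFun := fun v => ⟨_, (hmem v.1).1 v.2⟩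
      invFun := fun w => ⟨fun i => ⟨(w.1 (Sum.inl i)).re, (w.1 (Sum.inl i)).im,
        (w.1 (Sum.inr i)).re, (w.1 (Sum.inr i)).im⟩, (hmem _).2 (by
          convert w.2 using 1
          ext (i | i) <;> rfl)⟩
      map_add' := fun v w => by ext (i | i) <;> rfl
      map_smul' := fun c v => by
        ext (i | i) <;> apply Complex.ext <;> simp [fstPart, sndPart]
      left_inv := fun v => rfl
      right_inv := fun w => by ext (i | i) <;> rfl }
  have h1 := Module.finrank_mul_finrank ℝ ℍ[ℝ] W
  have h2 := Module.finrank_mul_finrank ℝ ℂ K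
  rw [Quaternion.finrank_eq_four] at h1
  rw [Complex.finrank_real_complex, ← e.finrank_eq] at h2
  have h3 : nullity (complexify A) = Module.finrank ℂ K := by
    have h4 := rank_add_nullity (complexify A)
    have h5 := rank_add_nullity (complexify A)ᵀ
    rw [Matrix.rank_transpose] at h5
    change _ + Module.finrank ℂ K = _ at h5
    omega
  exact ⟨Module.finrank ℍ[ℝ] W, by omega⟩

end

/-! ### Jordan types of quaternionic matrices -/

section

variable {m n : Type*} [Fintype m] [DecidableEq m] [Fintype n] [DecidableEq n]

/-- The eigenvalues in a Jordan type are replaced by their conjugates. -/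
def conjType (s : Multiset (ℕ × ℂ)) : Multiset (ℕ × ℂ) :=
  s.map fun p => (p.1, starRingEnd ℂ p.2)

/-- The eigenvalues in a Jordan type are regarded as quaternions. -/
def quaternionType (s : Multiset (ℕ × ℂ)) : Multiset (ℕ × ℍ[ℝ]) :=
  s.map fun p => (p.1, (p.2 : ℍ[ℝ]))

theorem exists_fin_family {α : Type*} (s : Multiset α) :
    ∃ (r : ℕ) (f : Fin r → α), Finset.univ.val.map f = s := by
  refine ⟨s.toList.length, s.toList.get, ?_⟩
  rw [Fin.univ_val_map, List.ofFn_get, Multiset.coe_toList]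

theorem complexify_map_coe {m n : Type*} (A : Matrix m n ℂ) :
    complexify (A.map fun z => (z : ℍ[ℝ])) =
      Matrix.fromBlocks A 0 0 (A.map (starRingEnd ℂ)) := by
  rw [complexify]
  congr 1
  ext i j
  apply Complex.ext <;> simp [sndPart]

theorem complexify_jordanMatrix {ι : Type*} [DecidableEq ι] (f : ι → ℕ × ℂ) :
    complexify (jordanMatrix fun i => ((f i).1, ((f i).2 : ℍ[ℝ]))) =
      Matrix.fromBlocks (jordanMatrix f) 0 0 ((jordanMatrix f).map (starRingEnd ℂ)) := by
  rw [← complexify_map_coe]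
  exact congrArg complexify
    (jordanMatrix_map (Quaternion.ofComplex : ℂ →ₐ[ℝ] ℍ[ℝ]).toRingHom f).symm

theorem similar_jordanMatrix_sumElim {F ι κ : Type*} [Ring F] [Fintype ι] [DecidableEq ι]
    [Fintype κ] [DecidableEq κ] (f : ι → ℕ × F) (g : κ → ℕ × F) :
    Similar (jordanMatrix (Sum.elim f g))
      (Matrix.fromBlocks (jordanMatrix f) 0 0 (jordanMatrix g)) := by
  let e := (Equiv.sumSigmaDistrib fun i : ι ⊕ κ => Fin (Sum.elim f g i).1).symm
  suffices h : Matrix.fromBlocks (jordanMatrix f) 0 0 (jordanMatrix g) =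
      (jordanMatrix (Sum.elim f g)).submatrix e e by
    rw [h]; exact similar_submatrix _ e
  ext (⟨i, x⟩ | ⟨i, x⟩) (⟨j, y⟩ | ⟨j, y⟩) <;>
    simp only [jordanMatrix, Matrix.submatrix_apply, e,
      Matrix.fromBlocks_apply₁₁, Matrix.fromBlocks_apply₁₂, Matrix.fromBlocks_apply₂₁,
      Matrix.fromBlocks_apply₂₂, Sum.elim_inl, Sum.elim_inr]
  · by_cases h : i = j
    · subst h
      rw [Matrix.blockDiagonal'_apply_eq]
      exact (Matrix.blockDiagonal'_apply_eq
        (fun i => jordanBlock (Sum.elim f g i).1 (Sum.elim f g i).2) (Sum.inl i) x y).symm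
    · rw [Matrix.blockDiagonal'_apply_ne _ _ _ h]
      exact (Matrix.blockDiagonal'_apply_ne
        (fun i => jordanBlock (Sum.elim f g i).1 (Sum.elim f g i).2) (k := Sum.inl i)
        (k' := Sum.inl j) x y fun h' => h (Sum.inl_injective h')).symm
  · exact (Matrix.blockDiagonal'_apply_ne
        (fun i => jordanBlock (Sum.elim f g i).1 (Sum.elim f g i).2) (k := Sum.inl i)
        (k' := Sum.inr j) x y Sum.inl_ne_inr).symm
  · exact (Matrix.blockDiagonal'_apply_ne
        (fun i => jordanBlock (Sum.elim f g i).1 (Sum.elim f g i).2) (k := Sum.inr i)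
        (k' := Sum.inl j) x y Sum.inr_ne_inl).symm
  · by_cases h : i = j
    · subst h
      rw [Matrix.blockDiagonal'_apply_eq]
      exact (Matrix.blockDiagonal'_apply_eq
        (fun i => jordanBlock (Sum.elim f g i).1 (Sum.elim f g i).2) (Sum.inr i) x y).symm
    · rw [Matrix.blockDiagonal'_apply_ne _ _ _ h]
      exact (Matrix.blockDiagonal'_apply_ne
        (fun i => jordanBlock (Sum.elim f g i).1 (Sum.elim f g i).2) (k := Sum.inr i)
        (k' := Sum.inr j) x y fun h' => h (Sum.inr_injective h')).symm

theorem hasJordanType_complexify_jordanMatrix {r : ℕ} (f : Fin r → ℕ × ℂ)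
    (hf : ∀ i, 0 < (f i).1) :
    HasJordanType (complexify (jordanMatrix fun i => ((f i).1, ((f i).2 : ℍ[ℝ]))))
      (Finset.univ.val.map f + conjType (Finset.univ.val.map f)) := by
  rw [complexify_jordanMatrix, jordanMatrix_map]
  convert! hasJordanType_of_similar ?_ (similar_jordanMatrix_sumElim f fun i =>
    ((f i).1, starRingEnd ℂ (f i).2)).symm using 1
  · rw [← Finset.univ_disjSum_univ, Finset.val_disjSum, Multiset.disjSum, Multiset.map_add,
      Multiset.map_map, Multiset.map_map, conjType, Multiset.map_map]
    rfl
  · rintro (i | i) <;> exact hf i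

/-- This is the bridge to ℂ: Φ of a Jordan matrix with complex eigenvalues is that matrix together
with its conjugate. The converse rests on descent of similarity from ℂ to ℍ. -/
theorem hasJordanType_quaternionType_iff {X : Matrix m m ℍ[ℝ]} {s : Multiset (ℕ × ℂ)} :
    HasJordanType X (quaternionType s) ↔ HasJordanType (complexify X) (s + conjType s) := by
  obtain ⟨r, f, rfl⟩ := exists_fin_family s
  have hs : quaternionType (Finset.univ.val.map f) =
      Finset.univ.val.map fun i => ((f i).1, ((f i).2 : ℍ[ℝ])) := by
    rw [quaternionType, Multiset.map_map]; rfl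
  rw [hs]
  constructor
  · intro h
    have hf : ∀ i, 0 < (f i).1 := fun i => h.pos _ (Multiset.mem_map_of_mem _ (Finset.mem_univ i))
    exact (hasJordanType_complexify_jordanMatrix f hf).of_similar h.similar.complexify
  · intro h
    have hf : ∀ i, 0 < (f i).1 := fun i => h.pos _
      (Multiset.mem_add.2 (Or.inl (Multiset.mem_map_of_mem _ (Finset.mem_univ i))))
    exact hasJordanType_of_similar hf (similar_of_similar_complexify
      (h.similar_of_same (hasJordanType_complexify_jordanMatrix f hf)))

theorem sizes_add (s t : Multiset (ℕ × ℂ)) (l : ℂ) :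
    sizes (s + t) l = sizes s l + sizes t l := by
  rw [sizes, Multiset.filter_add, Multiset.map_add]; rfl

theorem sizes_map (φ ψ : ℂ → ℂ) (hφ : ∀ z w, φ z = w ↔ z = ψ w) (s : Multiset (ℕ × ℂ)) (l : ℂ) :
    sizes (s.map fun p => (p.1, φ p.2)) l = sizes s (ψ l) := by
  rw [sizes, Multiset.filter_map, Multiset.map_map, sizes]
  congr 1
  exact Multiset.filter_congr fun p _ => hφ _ _

theorem sizes_conjType (s : Multiset (ℕ × ℂ)) (l : ℂ) :
    sizes (conjType s) l = sizes s (starRingEnd ℂ l) :=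
  sizes_map _ _ (fun _ _ => ⟨fun h => by rw [← h, Complex.conj_conj],
    fun h => by rw [h, Complex.conj_conj]⟩) s l

theorem sizes_eq_zero_of_im_neg {s : Multiset (ℕ × ℂ)} (hs : ∀ p ∈ s, 0 ≤ p.2.im) {l : ℂ}
    (hl : l.im < 0) : sizes s l = 0 := by
  rw [sizes, Multiset.filter_eq_nil.2, Multiset.map_zero]
  rintro p hp rfl
  exact absurd (hs p hp) (not_le.2 hl)

theorem sizes_add_conjType_of_im_pos {s : Multiset (ℕ × ℂ)} (hs : ∀ p ∈ s, 0 ≤ p.2.im) {l : ℂ}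
    (hl : 0 < l.im) : sizes (s + conjType s) l = sizes s l := by
  rw [sizes_add, sizes_conjType, sizes_eq_zero_of_im_neg hs (l := starRingEnd ℂ l) (by simpa),
    add_zero]

theorem sizes_add_conjType_of_im_eq_zero (s : Multiset (ℕ × ℂ)) {l : ℂ}
    (hl : l.im = 0) : sizes (s + conjType s) l = sizes s l + sizes s l := by
  rw [sizes_add, sizes_conjType, Complex.conj_eq_iff_im.2 hl]

/-- `s` is the multiset of the sizes and eigenvalues of the blocks of a Jordan form of the
quaternionic matrix `X`, the eigenvalues being complex with non-negative imaginary part. -/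
def HasQuaternionType (X : Matrix m m ℍ[ℝ]) (s : Multiset (ℕ × ℂ)) : Prop :=
  (∀ p ∈ s, 0 ≤ p.2.im) ∧ HasJordanType X (quaternionType s)

theorem HasQuaternionType.pos {X : Matrix m m ℍ[ℝ]} {s : Multiset (ℕ × ℂ)}
    (h : HasQuaternionType X s) : ∀ p ∈ s, 0 < p.1 := fun _ hp =>
  h.2.pos _ (Multiset.mem_map_of_mem _ hp)

/-- The type can be recovered from `s + conjType s`: in the open upper half plane the two agree, and
on the real line every count is doubled. -/
theorem HasQuaternionType.unique {X : Matrix m m ℍ[ℝ]} {s t : Multiset (ℕ × ℂ)}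
    (hs : HasQuaternionType X s) (ht : HasQuaternionType X t) : s = t := by
  have h := (hasJordanType_quaternionType_iff.1 hs.2).unique
    (hasJordanType_quaternionType_iff.1 ht.2)
  refine eq_of_sizes_eq fun l => ?_
  rcases lt_trichotomy l.im 0 with hl | hl | hl
  · rw [sizes_eq_zero_of_im_neg hs.1 hl, sizes_eq_zero_of_im_neg ht.1 hl]
  · have h1 := congrArg (fun u => sizes u l) h
    simp only [sizes_add_conjType_of_im_eq_zero _ hl] at h1
    ext d
    have h2 := congrArg (Multiset.count d) h1
    rw [Multiset.count_add, Multiset.count_add] at h2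
    omega
  · rw [← sizes_add_conjType_of_im_pos hs.1 hl, h, sizes_add_conjType_of_im_pos ht.1 hl]

theorem complexify_neg {m n : Type*} (A : Matrix m n ℍ[ℝ]) : complexify (-A) = -complexify A := by
  rw [complexify, complexify, Matrix.fromBlocks_neg]
  congr 1

/-- Negation sends `z` to the lower half plane, and `-conj z` is the admissible representative of
the same class. On the side of Φ the two choices only exchange the summands `s` and `conjType s`. -/
theorem HasQuaternionType.neg {X : Matrix m m ℍ[ℝ]} {s : Multiset (ℕ × ℂ)}
    (h : HasQuaternionType X s) :
    HasQuaternionType (-X) (s.map fun p => (p.1, -starRingEnd ℂ p.2)) := by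
  constructor
  · intro p hp
    obtain ⟨q, hq, rfl⟩ := Multiset.mem_map.1 hp
    simpa using h.1 q hq
  · rw [hasJordanType_quaternionType_iff, complexify_neg]
    have h1 := (hasJordanType_quaternionType_iff.1 h.2).neg
    convert h1 using 1
    simp only [conjType, Multiset.map_add, Multiset.map_map, Function.comp_def, map_neg,
      Complex.conj_conj]
    exact add_comm _ _

/-- The structure matrix conjugates Φ(X) into its entrywise conjugate. -/
theorem hasJordanType_conj_complexify {X : Matrix m m ℍ[ℝ]} {s : Multiset (ℕ × ℂ)}
    (h : HasJordanType (complexify X) s) : conjType s = s := by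
  refine (h.map (starRingEnd ℂ)).unique (h.of_similar ?_)
  refine Similar.symm ⟨structureMatrix m, -structureMatrix m, ?_, ?_,
    (isQuaternionic_complexify X).symm⟩
  · rw [Matrix.mul_neg, structureMatrix_mul_self, neg_neg]
  · rw [Matrix.neg_mul, structureMatrix_mul_self, neg_neg]

/-- For real `x` the powers of Φ(X) - x are again in the image of Φ, hence have even nullity. The
number of blocks of a given size is, up to sign, a second difference of these nullities. -/
theorem even_count_of_im_eq_zero {X : Matrix m m ℍ[ℝ]} {s : Multiset (ℕ × ℂ)}
    (h : HasJordanType (complexify X) s) {p : ℕ × ℂ} (hp : p.2.im = 0) : Even (s.count p) := by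
  obtain ⟨d, l⟩ := p
  obtain ⟨x, rfl⟩ : ∃ x : ℝ, l = x := ⟨l.re, Complex.ext rfl (by simpa using hp)⟩
  have hN : ∀ k, Even ((sizes s x).map (min k)).sum := fun k => by
    rw [← nullity_pow_eq_sum h]
    have h1 : IsQuaternionic ((complexify X - (x : ℂ) • 1) ^ k) := by
      have := ((isQuaternionic_complexify X).add
        ((isQuaternionic_one (n := m)).smul (-x))).pow k
      rwa [Complex.ofReal_neg, neg_smul, ← sub_eq_add_neg] at this
    obtain ⟨Z, hZ⟩ := h1.exists_complexify_eq
    rw [← hZ]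
    exact even_nullity_complexify Z
  rw [← count_sizes]
  rcases d with _ | d
  · rw [Multiset.count_eq_zero_of_notMem fun h0 => (pos_of_mem_sizes h.pos _ h0).false]
    exact Even.zero
  · have h1 := sum_map_min_add (sizes s x) d
    have h2 := hN d
    have h3 := hN (d + 2)
    rw [Nat.even_iff] at *
    omega

theorem exists_add_self_eq {α : Type*} [DecidableEq α] (s : Multiset α)
    (h : ∀ x, Even (s.count x)) : ∃ t : Multiset α, t + t = s := by
  refine ⟨∑ x ∈ s.toFinset, (s.count x / 2) • {x}, ?_⟩
  rw [← Finset.sum_add_distrib]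
  conv_rhs => rw [← Multiset.toFinset_sum_count_nsmul_eq s]
  refine Finset.sum_congr rfl fun x _ => ?_
  rw [← add_nsmul]
  congr 1
  have := Nat.even_iff.1 (h x)
  omega

/-- From the Jordan type of Φ(X) one keeps the blocks in the open upper half plane and half of those
on the real line. Conjugation invariance restores the lower half plane. -/
theorem exists_hasQuaternionType (X : Matrix m m ℍ[ℝ]) : ∃ s, HasQuaternionType X s := by
  obtain ⟨s, hs⟩ := exists_hasJordanType (complexify X)
  have hconj := hasJordanType_conj_complexify hs
  obtain ⟨t, ht⟩ := exists_add_self_eq (s.filter fun p => p.2.im = 0) fun p => by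
    rw [Multiset.count_filter]
    split_ifs with hp
    · exact even_count_of_im_eq_zero hs hp
    · exact Even.zero
  have ht0 : ∀ p ∈ t, p.2.im = 0 := fun p hp => by
    have : p ∈ s.filter fun p => p.2.im = 0 := by
      rw [← ht]; exact Multiset.mem_add.2 (Or.inl hp)
    exact (Multiset.mem_filter.1 this).2
  have hu : ∀ p ∈ s.filter (fun p => 0 < p.2.im) + t, 0 ≤ p.2.im := fun p hp => by
    rcases Multiset.mem_add.1 hp with hp | hp
    · exact (Multiset.mem_filter.1 hp).2.le
    · exact (ht0 p hp).ge
  refine ⟨s.filter (fun p => 0 < p.2.im) + t, hu, ?_⟩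
  rw [hasJordanType_quaternionType_iff]
  convert hs using 1
  have hpos : ∀ l : ℂ, 0 < l.im → sizes (s.filter (fun p => 0 < p.2.im) + t) l = sizes s l := by
    intro l hl
    ext d
    rw [count_sizes, count_sizes, Multiset.count_add, Multiset.count_filter, if_pos hl,
      Multiset.count_eq_zero_of_notMem fun h => hl.ne' (ht0 _ h), add_zero]
  refine eq_of_sizes_eq fun l => ?_
  rcases lt_trichotomy l.im 0 with hl | hl | hl
  · have hl' : 0 < (starRingEnd ℂ l).im := by simpa
    rw [sizes_add, sizes_conjType, sizes_eq_zero_of_im_neg hu hl, zero_add, hpos _ hl',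
      ← sizes_conjType, hconj]
  · rw [sizes_add_conjType_of_im_eq_zero _ hl]
    ext d
    have h1 := congrArg (Multiset.count (d, l)) ht
    rw [Multiset.count_add, Multiset.count_filter, if_pos hl] at h1
    rw [Multiset.count_add, count_sizes, count_sizes, Multiset.count_add, Multiset.count_filter,
      if_neg (by exact hl.le.not_gt), zero_add, h1]
  · rw [sizes_add_conjType_of_im_pos hu hl, hpos l hl]

end

/-! ### Eigenvalues and multiplicities of quaternionic matrices -/

section

variable {n : ℕ}

theorem complexRep_im_nonneg (l : ℍ[ℝ]) : 0 ≤ (complexRep l).im := norm_nonneg _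

theorem complexRep_neg (l : ℍ[ℝ]) : complexRep (-l) = -starRingEnd ℂ (complexRep l) := by
  apply Complex.ext <;> simp [complexRep]

theorem complexRep_coe {z : ℂ} (hz : 0 ≤ z.im) : complexRep (z : ℍ[ℝ]) = z := by
  apply Complex.ext
  · simp [complexRep]
  · have h : ‖(z : ℍ[ℝ]).im‖ * ‖(z : ℍ[ℝ]).im‖ = z.im * z.im := by
      rw [← Quaternion.normSq_eq_norm_mul_self, Quaternion.normSq_def']
      simp [sq]
    exact (mul_self_inj (norm_nonneg _) hz).1 h

theorem exists_mul_eq_mul_complexRep (l : ℍ[ℝ]) :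
    ∃ q : ℍ[ℝ], q ≠ 0 ∧ l * q = q * (complexRep l : ℍ[ℝ]) := by
  set r : ℝ := ‖l.im‖ with hr
  have h : r * r = l.imI ^ 2 + l.imJ ^ 2 + l.imK ^ 2 := by
    rw [hr, ← Quaternion.normSq_eq_norm_mul_self, Quaternion.normSq_def']
    simp
  -- For a purely imaginary `q`, these equations yield the four components of the required identity.
  have key : ∀ q : ℍ[ℝ], q.re = 0 → (l.imI - r) * q.imI + l.imJ * q.imJ + l.imK * q.imK = 0 →
      l.imJ * q.imK = l.imK * q.imJ → l.imK * q.imI = (l.imI + r) * q.imK →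
      l.imJ * q.imI = (l.imI + r) * q.imJ → l * q = q * (complexRep l : ℍ[ℝ]) := by
    intro q h0 h1 h2 h3 h4
    have w0 : (complexRep l : ℍ[ℝ]).re = l.re := rfl
    have w1 : (complexRep l : ℍ[ℝ]).imI = r := rfl
    have w2 : (complexRep l : ℍ[ℝ]).imJ = 0 := rfl
    have w3 : (complexRep l : ℍ[ℝ]).imK = 0 := rfl
    ext <;> simp only [Quaternion.re_mul, Quaternion.imI_mul, Quaternion.imJ_mul,
      Quaternion.imK_mul, w0, w1, w2, w3, h0] <;> linarith
  -- In general `q = im l + r i` works, since `(im l)² = -r² = (r i)²`. It vanishes exactly when `im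
  -- l = -r i`, and then `q = j` serves.
  by_cases h0 : l.imI + r = 0 ∧ l.imJ = 0 ∧ l.imK = 0
  · obtain ⟨h1, h2, h3⟩ := h0
    refine ⟨⟨0, 0, 1, 0⟩, fun h => one_ne_zero (congrArg (fun q : ℍ[ℝ] => q.imJ) h), ?_⟩
    apply key <;> simp [h1, h2, h3]
  · refine ⟨⟨0, l.imI + r, l.imJ, l.imK⟩, fun h => h0 ?_, ?_⟩
    · exact ⟨congrArg (fun q : ℍ[ℝ] => q.imI) h, congrArg (fun q : ℍ[ℝ] => q.imJ) h,
        congrArg (fun q : ℍ[ℝ] => q.imK) h⟩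
    · apply key <;> dsimp only <;> linarith

theorem IsRightEigenvalue.of_mul_eq {X : Matrix (Fin n) (Fin n) ℍ[ℝ]} {l l' q : ℍ[ℝ]}
    (hq : q ≠ 0) (h : l * q = q * l') : IsRightEigenvalue X l → IsRightEigenvalue X l' := by
  rintro ⟨v, hv, hXv⟩
  refine ⟨fun i => v i * q, fun h0 => hv ?_, ?_⟩
  · ext1 i
    exact (mul_eq_zero.1 (congrFun h0 i)).resolve_right hq
  · ext1 i
    have h1 := congrFun hXv i
    simp only [Matrix.mulVec, dotProduct] at h1 ⊢
    simp only [← mul_assoc]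
    rw [← Finset.sum_mul, h1, mul_assoc, h, mul_assoc]

theorem isRightEigenvalue_iff_complexRep (X : Matrix (Fin n) (Fin n) ℍ[ℝ]) (l : ℍ[ℝ]) :
    IsRightEigenvalue X l ↔ IsRightEigenvalue X (complexRep l : ℍ[ℝ]) := by
  obtain ⟨q, hq, h⟩ := exists_mul_eq_mul_complexRep l
  refine ⟨.of_mul_eq hq h, .of_mul_eq (inv_ne_zero hq) ?_⟩
  rw [eq_inv_mul_iff_mul_eq₀ hq, ← mul_assoc, ← h, mul_assoc, mul_inv_cancel₀ hq, mul_one]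

theorem isRightEigenvalue_coe_iff (X : Matrix (Fin n) (Fin n) ℍ[ℝ]) (z : ℂ) :
    IsRightEigenvalue X (z : ℍ[ℝ]) ↔
      Module.End.HasEigenvalue (Matrix.toLin' (complexify X)) z := by
  -- This is the first column of Φ applied to the column `v`. It turns `X` into Φ(X) and right
  -- multiplication by a complex number into scalar multiplication.
  let w : (Fin n → ℍ[ℝ]) → Fin n ⊕ Fin n → ℂ := fun v =>
    Sum.elim (fun i => fstPart (v i)) (fun i => -starRingEnd ℂ (sndPart (v i)))
  have hw : Function.Injective w := fun v v' h => by
    ext1 i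
    have h1 := congrFun h (Sum.inl i)
    have h2 := congrFun h (Sum.inr i)
    simp only [w, Sum.elim_inl, Sum.elim_inr, neg_inj] at h1 h2
    exact fstPart_sndPart_ext h1 ((starRingEnd ℂ).injective h2)
  have hw_surj : Function.Surjective w := fun u => by
    refine ⟨fun i => ⟨(u (Sum.inl i)).re, (u (Sum.inl i)).im, -(u (Sum.inr i)).re,
      (u (Sum.inr i)).im⟩, ?_⟩
    ext (i | i) <;> apply Complex.ext <;> simp [w, fstPart, sndPart]
  have hw0 : w 0 = 0 := by
    ext (i | i) <;> apply Complex.ext <;> simp [w, fstPart, sndPart]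
  have hX : ∀ v, w (X *ᵥ v) = complexify X *ᵥ w v := fun v => by
    ext (i | i)
    · simp [w, Matrix.mulVec, dotProduct, fstPart_sum, fstPart_mul, complexify, sub_eq_add_neg,
        Finset.sum_add_distrib]
    · simp [w, Matrix.mulVec, dotProduct, sndPart_sum, sndPart_mul, complexify,
        Finset.sum_add_distrib, add_comm]
  have hz : ∀ v : Fin n → ℍ[ℝ], w (fun i => v i * (z : ℍ[ℝ])) = z • w v := fun v => by
    have h1 : fstPart (z : ℍ[ℝ]) = z := rfl
    have h2 : sndPart (z : ℍ[ℝ]) = 0 := rfl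
    ext (i | i) <;> simp [w, fstPart_mul, sndPart_mul, h1, h2, mul_comm]
  constructor
  · rintro ⟨v, hv, hXv⟩
    refine Module.End.hasEigenvalue_of_hasEigenvector (x := w v)
      (Module.End.hasEigenvector_iff.2 ⟨Module.End.mem_eigenspace_iff.2 ?_, fun h => hv ?_⟩)
    · rw [Matrix.toLin'_apply, ← hX, ← hz, ← hXv]
    · exact hw (h.trans hw0.symm)
  · intro h
    obtain ⟨u, hu⟩ := h.exists_hasEigenvector
    obtain ⟨v, rfl⟩ := hw_surj u
    refine ⟨v, fun h0 => hu.2 (by rw [h0, hw0]), hw ?_⟩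
    have := hu.apply_eq_smul
    rw [Matrix.toLin'_apply] at this
    rw [hX, this, hz]

theorem isRightEigenvalue_iff {X : Matrix (Fin n) (Fin n) ℍ[ℝ]} {s : Multiset (ℕ × ℂ)}
    (h : HasQuaternionType X s) (l : ℍ[ℝ]) :
    IsRightEigenvalue X l ↔ sizes s (complexRep l) ≠ 0 := by
  rw [isRightEigenvalue_iff_complexRep, isRightEigenvalue_coe_iff,
    hasEigenvalue_iff_sizes_ne_zero (hasJordanType_quaternionType_iff.1 h.2)]
  rcases (complexRep_im_nonneg l).eq_or_lt with hl | hl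
  · rw [sizes_add_conjType_of_im_eq_zero _ hl.symm, Ne, add_eq_zero, and_self]
  · rw [sizes_add_conjType_of_im_pos h.1 hl]

theorem quaternionMult_eq {X : Matrix (Fin n) (Fin n) ℍ[ℝ]} {s : Multiset (ℕ × ℂ)}
    (h : HasQuaternionType X s) (l : ℍ[ℝ]) :
    quaternionMult X l = (sizes s (complexRep l)).sum := by
  have h1 := rootMultiplicity_charpoly (hasJordanType_quaternionType_iff.1 h.2) (complexRep l)
  change (toComplex X).charpoly.rootMultiplicity (complexRep l) = _ at h1
  rw [quaternionMult, h1]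
  split_ifs with hl
  · rw [sizes_add_conjType_of_im_eq_zero _ hl, Multiset.sum_add]
    omega
  · rw [sizes_add_conjType_of_im_pos h.1 (lt_of_le_of_ne (complexRep_im_nonneg l) (Ne.symm hl))]

/-! ### The partitions attached to the eigenvalues -/

theorem isComplexPartition_iff {X : Matrix (Fin n) (Fin n) ℂ} {s : Multiset (ℕ × ℂ)}
    (h : HasJordanType X s) (l : ℂ) {m : ℕ} (p : Nat.Partition m) :
    IsComplexPartition X l p ↔ p.parts = sizes s l := by
  have hsizes : ∀ {r : ℕ} (d : Fin r → ℕ) (a : Fin r → ℂ),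
      ((Finset.univ : Finset (Fin r)).filter fun i => a i = l).val.map d =
        sizes (Finset.univ.val.map fun i => (d i, a i)) l := fun d a => by
    rw [sizes, Multiset.filter_map, Multiset.map_map]; rfl
  constructor
  · rintro ⟨r, d, a, hJ, hp⟩
    rw [hasJordanForm_iff] at hJ
    rw [hp, hsizes, h.unique (hasJordanType_of_similar (f := fun i => (d i, a i)) hJ.1 hJ.2)]
  · intro hp
    obtain ⟨r, f, hf, rfl, hX⟩ := h
    exact ⟨r, fun i => (f i).1, fun i => (f i).2, (hasJordanForm_iff _ _ _).2 ⟨hf, hX⟩,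
      by rw [hp, hsizes]⟩

theorem isQuaternionPartition_iff {X : Matrix (Fin n) (Fin n) ℍ[ℝ]} {s : Multiset (ℕ × ℂ)}
    (h : HasQuaternionType X s) (l : ℍ[ℝ]) {m : ℕ} (p : Nat.Partition m) :
    IsQuaternionPartition X l p ↔ p.parts = sizes s (complexRep l) := by
  have hsizes : ∀ {r : ℕ} (d : Fin r → ℕ) (a : Fin r → ℂ),
      ((Finset.univ : Finset (Fin r)).filter fun i => a i = complexRep l).val.map d =
        sizes (Finset.univ.val.map fun i => (d i, a i)) (complexRep l) := fun d a => by
    rw [sizes, Multiset.filter_map, Multiset.map_map]; rfl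
  have hq : ∀ {r : ℕ} (f : Fin r → ℕ × ℂ), quaternionType (Finset.univ.val.map f) =
      Finset.univ.val.map fun i => ((f i).1, ((f i).2 : ℍ[ℝ])) := fun f => by
    rw [quaternionType, Multiset.map_map]; rfl
  constructor
  · rintro ⟨r, d, a, ha, hJ, hp⟩
    rw [hasJordanForm_iff] at hJ
    rw [hp, hsizes, h.unique (t := Finset.univ.val.map fun i => (d i, a i)) ⟨by simpa using ha, ?_⟩]
    rw [hq]
    exact hasJordanType_of_similar (f := fun i => (d i, (a i : ℍ[ℝ]))) hJ.1 hJ.2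
  · intro hp
    obtain ⟨r, f, rfl⟩ := exists_fin_family s
    have hX := h.2
    rw [hq] at hX
    exact ⟨r, fun i => (f i).1, fun i => (f i).2,
      fun i => h.1 _ (Multiset.mem_map_of_mem _ (Finset.mem_univ i)), (hasJordanForm_iff _ _ _).2
        ⟨fun i => h.pos _ (Multiset.mem_map_of_mem _ (Finset.mem_univ i)), hX.similar⟩,
      by rw [hp, hsizes]⟩

/-! ### Conjugation by elements of determinant one -/

theorem isRealSLC_iff (X : Matrix (Fin n) (Fin n) ℂ) : IsRealSLC X ↔ Similar X (-X) := by
  constructor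
  · rintro ⟨g, hg⟩
    refine similar_iff_exists_units.2
      ⟨⟨g, (g⁻¹ : Matrix.SpecialLinearGroup (Fin n) ℂ), ?_, ?_⟩, hg.symm⟩
    · rw [← Matrix.SpecialLinearGroup.coe_mul, mul_inv_cancel, Matrix.SpecialLinearGroup.coe_one]
    · rw [← Matrix.SpecialLinearGroup.coe_mul, inv_mul_cancel, Matrix.SpecialLinearGroup.coe_one]
  · intro h
    obtain ⟨g, hg⟩ := similar_iff_exists_units.1 h
    rcases Nat.eq_zero_or_pos n with rfl | hn
    · exact ⟨1, Subsingleton.elim _ _⟩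
    have hdet : (g : Matrix (Fin n) (Fin n) ℂ).det ≠ 0 :=
      ((Matrix.isUnit_iff_isUnit_det _).1 g.isUnit).ne_zero
    -- Scaling by `c` multiplies the determinant by `c ^ n` and does not affect conjugation.
    obtain ⟨c, hc⟩ := IsAlgClosed.exists_pow_nat_eq (g : Matrix (Fin n) (Fin n) ℂ).det⁻¹ hn
    let g' : Matrix.SpecialLinearGroup (Fin n) ℂ := ⟨c • (g : Matrix (Fin n) (Fin n) ℂ), by
      rw [Matrix.det_smul, Fintype.card_fin, hc, inv_mul_cancel₀ hdet]⟩
    refine ⟨g', ?_⟩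
    have h1 : (g' : Matrix (Fin n) (Fin n) ℂ) * X = -X * g' := by
      change (c • (g : Matrix (Fin n) (Fin n) ℂ)) * X = -X * (c • (g : Matrix (Fin n) (Fin n) ℂ))
      rw [← hg, Matrix.smul_mul, Matrix.mul_smul, Units.inv_mul_cancel_right]
    rw [h1, Matrix.mul_assoc, ← Matrix.SpecialLinearGroup.coe_mul, mul_inv_cancel,
      Matrix.SpecialLinearGroup.coe_one, Matrix.mul_one]

theorem Similar.det_eq {m n : Type*} [Fintype m] [DecidableEq m] [Fintype n] [DecidableEq n]
    {A : Matrix m m ℂ} {B : Matrix n n ℂ} (h : Similar A B) : A.det = B.det := by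
  let e := Fintype.equivOfCardEq h.card_eq
  obtain ⟨g, hg⟩ := similar_iff_exists_units.1 (h.trans (similar_submatrix B e))
  rw [← Matrix.det_submatrix_equiv_self e B, ← hg, Matrix.det_units_conj]

/-- By the quaternionic Jordan form, the determinant is that of a complex matrix times its
conjugate. -/
theorem exists_det_complexify_eq (A : Matrix (Fin n) (Fin n) ℍ[ℝ]) :
    ∃ x : ℝ, 0 ≤ x ∧ (complexify A).det = x := by
  obtain ⟨s, hs⟩ := exists_hasQuaternionType A
  obtain ⟨r, f, rfl⟩ := exists_fin_family s
  have hA := hs.2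
  rw [quaternionType, Multiset.map_map] at hA
  have h1 := (HasJordanType.similar (f := fun i => ((f i).1, ((f i).2 : ℍ[ℝ])))
    hA).complexify.det_eq
  refine ⟨Complex.normSq (jordanMatrix f).det, Complex.normSq_nonneg _, ?_⟩
  rw [h1, complexify_jordanMatrix, Matrix.det_fromBlocks_zero₂₁, Complex.normSq_eq_conj_mul_self,
    mul_comm, RingHom.map_det]
  rfl

theorem isRealSLH_iff (X : Matrix (Fin n) (Fin n) ℍ[ℝ]) : IsRealSLH X ↔ Similar X (-X) := by
  constructor
  · rintro ⟨g, -, hg⟩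
    exact similar_iff_exists_units.2 ⟨g, hg.symm⟩
  · intro h
    obtain ⟨g, hg⟩ := similar_iff_exists_units.1 h
    rcases Nat.eq_zero_or_pos n with rfl | hn
    · exact ⟨1, one_mem _, Subsingleton.elim _ _⟩
    obtain ⟨x, hx0, hx⟩ := exists_det_complexify_eq (g : Matrix (Fin n) (Fin n) ℍ[ℝ])
    have hx' : x ≠ 0 := by
      rintro rfl
      have h1 := congrArg (fun M => (complexify M).det) g.mul_inv
      simp only [complexify_mul, complexify_one, Matrix.det_mul, Matrix.det_one, hx] at h1
      simp at h1
    have hpos : 0 < x⁻¹ := inv_pos.2 (lt_of_le_of_ne hx0 hx'.symm)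
    -- Φ(g) has size `2n`, so a `2n`-th root is needed. A real scalar is central in ℍ, so
    -- conjugation is unchanged.
    set c : ℝ := x⁻¹ ^ (((n + n : ℕ) : ℝ)⁻¹) with hc
    have hc0 : c ≠ 0 := (Real.rpow_pos_of_pos hpos _).ne'
    have hcn : c ^ (n + n) = x⁻¹ := Real.rpow_inv_natCast_pow hpos.le (by omega)
    let g' : (Matrix (Fin n) (Fin n) ℍ[ℝ])ˣ := Units.mk0 c hc0 • g
    have hval : (g' : Matrix (Fin n) (Fin n) ℍ[ℝ]) = c • (g : Matrix (Fin n) (Fin n) ℍ[ℝ]) := rfl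
    have hcomplexify : complexify (c • (g : Matrix (Fin n) (Fin n) ℍ[ℝ])) =
        (c : ℂ) • complexify (g : Matrix (Fin n) (Fin n) ℍ[ℝ]) := by
      ext (i | i) (j | j) <;> apply Complex.ext <;> simp [complexify, fstPart, sndPart]
    refine ⟨g', ?_, ?_⟩
    · change (complexify (g' : Matrix (Fin n) (Fin n) ℍ[ℝ])).det = 1
      rw [hval, hcomplexify, Matrix.det_smul, hx, Fintype.card_sum, Fintype.card_fin]
      exact_mod_cast by rw [hcn, inv_mul_cancel₀ hx']
    · have h1 : (g' : Matrix (Fin n) (Fin n) ℍ[ℝ]) * X = -X * g' := by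
        rw [hval, ← hg, Matrix.smul_mul, Matrix.mul_smul, Units.inv_mul_cancel_right]
      rw [h1, Matrix.mul_assoc, Units.mul_inv, Matrix.mul_one]

/-! ### The two conditions in terms of the sizes of the blocks -/

/-- A common form of the two cases: `S l` is the multiset of block sizes, `P` selects the
constrained eigenvalues, `E` says that `l` is an eigenvalue, `M` is the multiplicity and `D` the
partition relation. -/
theorem conditions_iff {α : Type*} [InvolutiveNeg α] {P E : α → Prop} {M : α → ℕ}
    {D : α → ∀ m, Nat.Partition m → Prop} {S : α → Multiset ℕ} (hP : ∀ l, P l → P (-l))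
    (hS : ∀ l, ∀ x ∈ S l, 0 < x) (hE : ∀ l, E l ↔ S l ≠ 0) (hM : ∀ l, M l = (S l).sum)
    (hD : ∀ l m (p : Nat.Partition m), D l m p ↔ p.parts = S l) :
    ((∀ l, P l → E l → E (-l) ∧ M (-l) = M l) ∧
      (∀ l, P l → E l → ∀ m, M l = m → M (-l) = m →
        ∀ p q : Nat.Partition m, D l m p → D (-l) m q → p = q)) ↔
      ∀ l, P l → S (-l) = S l := by
  constructor
  · rintro ⟨h1, h2⟩ l hl
    by_cases h0 : S l = 0
    · by_contra hne
      rw [h0] at hne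
      -- If only `-l` had blocks, the first condition at `-l` would make `l` an eigenvalue.
      have := (h1 (-l) (hP l hl) ((hE _).2 hne)).1
      rw [neg_neg, hE] at this
      exact this h0
    · have hEl := (hE l).2 h0
      have hm := (h1 l hl hEl).2
      -- The multisets `S l` and `S (-l)` are themselves partitions of the common multiplicity, so
      -- the second condition applies to them.
      have hpq := h2 l hl hEl _ rfl hm ⟨S l, fun {x} => hS l x, (hM l).symm⟩
        ⟨S (-l), fun {x} => hS (-l) x, by rw [← hM, hm]⟩ ((hD _ _ _).2 rfl) ((hD _ _ _).2 rfl)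
      exact (congrArg Nat.Partition.parts hpq).symm
  · intro h
    refine ⟨fun l hl hEl => ⟨?_, by rw [hM, hM, h l hl]⟩, fun l hl _ m _ _ p q hp hq => ?_⟩
    · rw [hE, h l hl, ← hE]
      exact hEl
    · rw [hD] at hp hq
      exact Nat.Partition.ext (by rw [hp, hq, h l hl])

/-! ### Ad-reality as a symmetry of the block sizes -/

theorem isRealSLC_iff_sizes {X : Matrix (Fin n) (Fin n) ℂ} {s : Multiset (ℕ × ℂ)}
    (hs : HasJordanType X s) : IsRealSLC X ↔ ∀ l : ℂ, l ≠ 0 → sizes s (-l) = sizes s l := by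
  have hsizes : ∀ l, sizes (s.map fun p => (p.1, -p.2)) l = sizes s (-l) :=
    sizes_map _ _ (fun _ _ => neg_eq_iff_eq_neg) s
  rw [isRealSLC_iff]
  constructor
  · intro h l _
    rw [← hsizes, ← hs.unique (hs.neg.of_similar h)]
  · intro h
    have : (s.map fun p => (p.1, -p.2)) = s := eq_of_sizes_eq fun l => by
      rw [hsizes]
      rcases eq_or_ne l 0 with rfl | hl
      · rw [neg_zero]
      · exact h l hl
    exact hs.similar_of_same (this ▸ hs.neg)

theorem isRealSLH_iff_sizes {X : Matrix (Fin n) (Fin n) ℍ[ℝ]} {s : Multiset (ℕ × ℂ)}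
    (hs : HasQuaternionType X s) : IsRealSLH X ↔ ∀ l : ℍ[ℝ], l.re ≠ 0 →
      sizes s (complexRep (-l)) = sizes s (complexRep l) := by
  have hsizes : ∀ l, sizes (s.map fun p => (p.1, -starRingEnd ℂ p.2)) l =
      sizes s (-starRingEnd ℂ l) := sizes_map (fun z => -starRingEnd ℂ z) _ (fun z w =>
    ⟨fun h => by rw [← h, map_neg, neg_neg, Complex.conj_conj],
      fun h => by rw [h, map_neg, neg_neg, Complex.conj_conj]⟩) s
  rw [isRealSLH_iff]
  constructor
  · intro h l _
    have h1 : HasQuaternionType X (s.map fun p => (p.1, -starRingEnd ℂ p.2)) :=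
      ⟨hs.neg.1, hs.neg.2.of_similar h⟩
    rw [complexRep_neg, ← hsizes, ← hs.unique h1]
  · intro h
    have : (s.map fun p => (p.1, -starRingEnd ℂ p.2)) = s := eq_of_sizes_eq fun l => by
      rw [hsizes]
      -- The map `l ↦ -conj l` preserves the imaginary part: below the real axis both sides are
      -- empty, and on the imaginary axis `l` is fixed. Otherwise the hypothesis applies to `l`
      -- viewed as a quaternion.
      rcases lt_or_ge l.im 0 with hl | hl
      · rw [sizes_eq_zero_of_im_neg hs.1 hl, sizes_eq_zero_of_im_neg hs.1 (by simpa using hl)]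
      · by_cases hre : l.re = 0
        · congr 1
          apply Complex.ext <;> simp [hre]
        · have := h (l : ℍ[ℝ]) hre
          rwa [complexRep_neg, complexRep_coe hl] at this
    have hneg := hs.neg.2
    rw [this] at hneg
    exact hs.2.similar_of_same hneg

end

end AdReal

end

theorem theorem1p1 (n : ℕ) :
    (∀ X : Matrix (Fin n) (Fin n) ℂ, X ∈ LieAlgebra.SpecialLinear.sl (Fin n) ℂ →
      (AdReal.IsRealSLC X ↔
        (∀ l : ℂ, l ≠ 0 → Module.End.HasEigenvalue (Matrix.toLin' X) l →
          Module.End.HasEigenvalue (Matrix.toLin' X) (-l) ∧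
            AdReal.complexMult X (-l) = AdReal.complexMult X l) ∧
        (∀ l : ℂ, l ≠ 0 → Module.End.HasEigenvalue (Matrix.toLin' X) l →
          ∀ (m : ℕ), AdReal.complexMult X l = m → AdReal.complexMult X (-l) = m →
            ∀ p q : Nat.Partition m, AdReal.IsComplexPartition X l p →
              AdReal.IsComplexPartition X (-l) q → p = q))) ∧
    (∀ X : Matrix (Fin n) (Fin n) ℍ[ℝ], X ∈ AdReal.slH n →
      (AdReal.IsRealSLH X ↔
        (∀ l : ℍ[ℝ], l.re ≠ 0 → AdReal.IsRightEigenvalue X l →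
          AdReal.IsRightEigenvalue X (-l) ∧
            AdReal.quaternionMult X (-l) = AdReal.quaternionMult X l) ∧
        (∀ l : ℍ[ℝ], l.re ≠ 0 → AdReal.IsRightEigenvalue X l →
          ∀ (m : ℕ), AdReal.quaternionMult X l = m → AdReal.quaternionMult X (-l) = m →
            ∀ p q : Nat.Partition m, AdReal.IsQuaternionPartition X l p →
              AdReal.IsQuaternionPartition X (-l) q → p = q))) := by
  refine ⟨fun X _ => ?_, fun X _ => ?_⟩
  · obtain ⟨s, hs⟩ := AdReal.exists_hasJordanType X
    rw [AdReal.isRealSLC_iff_sizes hs]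
    exact (AdReal.conditions_iff (P := fun l => l ≠ 0) (M := AdReal.complexMult X)
      (D := fun l _ p => AdReal.IsComplexPartition X l p)
      (fun _ => neg_ne_zero.2) (fun _ => AdReal.pos_of_mem_sizes hs.pos)
      (AdReal.hasEigenvalue_iff_sizes_ne_zero hs) (AdReal.rootMultiplicity_charpoly hs)
      (fun l _ p => AdReal.isComplexPartition_iff hs l p)).symm
  · obtain ⟨s, hs⟩ := AdReal.exists_hasQuaternionType X
    rw [AdReal.isRealSLH_iff_sizes hs]
    exact (AdReal.conditions_iff (P := fun l => l.re ≠ 0) (M := AdReal.quaternionMult X)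
      (D := fun l _ p => AdReal.IsQuaternionPartition X l p)
      (S := fun l => AdReal.sizes s (AdReal.complexRep l))
      (fun l hl => by simpa using hl) (fun _ => AdReal.pos_of_mem_sizes hs.pos)
      (AdReal.isRightEigenvalue_iff hs) (AdReal.quaternionMult_eq hs)
      (fun l _ p => AdReal.isQuaternionPartition_iff hs l p)).symm
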